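/- Let $A$ be a separable (not necessarily unital) $C^*$-algebra and $\alpha$ a $*$-automorphism of $A$. Let $Q(A)$ be the quasi-state space of $A$, that is, the set of positive linear functionals on $A$ of norm at most one, with the weak$^*$ topology, and let $\tilde T_\alpha : Q(A)\to Q(A)$ be the homeomorphism $\sigma\mapsto\sigma\circ\alpha$. Write $h_{\rm top}(T)=\sup_{\mathcal U}\lim_{n\to\infty}\frac1n\log N(\mathcal U\vee T^{-1}\mathcal U\vee\cdots\vee T^{-(n-1)}\mathcal U)$ for the topological entropy of $T$, where $\mathcal U$ ranges over the finite open covers and $N(\cdot)$ is the smallest cardinality of a subcover. For a set $I$, $\ell_1^I$ is the complex $\ell_1$ space over $I$ with standard basis $(e_i)_{i\in I}$. By an isomorphism we mean a surjective linear homeomorphism of normed spaces, and an isomorphism $\Gamma$ is a $K$-isomorphism if $\|\Gamma\|\,\|\Gamma^{-1}\|\le K$. An $\ell_1$ isomorphism set for $a\in A$ is an infinite set $I\subseteq\mathbb Z$ for which there is an isomorphism from $\ell_1^I$ onto $\overline{\rm span}\{\alpha^i(a): i\in I\}$ sending $e_i$ to $\alpha^i(a)$ for each $i\in I$. The density of $J\subseteq\mathbb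 Z$ is $\lim_{n\to\infty}|J\cap\{-n,\dots,n\}|/(2n+1)$, if this limit exists. Then the following are equivalent: 1. $h_{\rm top}(\tilde T_\alpha)=\infty$; 2. there exist an $a\in A$, constants $K,d>0$, a sequence $\{n_k\}_{k\in\mathbb N}$ in $\mathbb N$ going to $\infty$, and sets $I_k\subseteq\{0,1,\dots,n_k-1\}$ of cardinality at least $d n_k$ such that, for each $k\in\mathbb N$, the linear map from $\ell_1^{I_k}$ to ${\rm span}\{\alpha^i(a): i\in I_k\}$ which sends $e_i$ to $\alpha^i(a)$ for each $i\in I_k$ is a $K$-isomorphism; 3. there exists an $a\in A$ with an $\ell_1$ isomorphism set whose density exists and is positive. Moreover, let $W$ be any countable total subset of the real Banach space $A_{\rm sa}$ of self-adjoint elements of $A$ (total means that its real linear span is dense in $A_{\rm sa}$). Then (1) is also equivalent to (2) with the additional requirement $a\in W$, and to (3) with the additional requirement $a\in W$. Finally, when $A$ is unital, the conditions (1)–(3) are also equivalent to 4. $h_{\rm top}(T_\alpha)=\infty$, where $T_\alpha$ is the homeomorphism $\sigma\mapsto\sigma\circ\alpha$ of the state space $S(A)$ (the positive linear functionals $\sigma$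 on $A$ with $\sigma(1)=1$, with the weak$^*$ topology). -/

import Mathlib

open Filter Topology
open scoped ComplexOrder

noncomputable section

/-! ### Topological entropy via finite open covers -/

/-- `N(𝒰)`: the smallest cardinality of a (finite) subcover of the family `𝒰` of subsets of `X`. -/
def coverNumber {X : Type*} (U : Set (Set X)) : ℕ :=
  sInf {m : ℕ | ∃ F : Finset (Set X), (F : Set (Set X)) ⊆ U ∧
    ⋃₀ (F : Set (Set X)) = Set.univ ∧ F.card = m}

/-- The join `𝒰 ∨ 𝒱 = {u ∩ v : u ∈ 𝒰, v ∈ 𝒱}` of two families of sets. -/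
def coverJoin {X : Type*} (U V : Set (Set X)) : Set (Set X) :=
  Set.image2 (fun u v => u ∩ v) U V

/-- The pullback `T⁻¹𝒰 = {T⁻¹u : u ∈ 𝒰}`. -/
def coverPullback {X : Type*} (T : X → X) (U : Set (Set X)) : Set (Set X) :=
  (fun u => T ⁻¹' u) '' U

/-- `𝒰 ∨ T⁻¹𝒰 ∨ ⋯ ∨ T^{-(n-1)}𝒰` (the trivial cover `{X}` when `n = 0`). -/
def dynCover {X : Type*} (T : X → X) (U : Set (Set X)) : ℕ → Set (Set X)
  | 0 => {Set.univ}
  | n + 1 => coverJoin (dynCover T U n) (coverPullback (T^[n]) U)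

/-- `U` is a finite open cover of `X`. -/
structure IsFiniteOpenCover {X : Type*} [TopologicalSpace X] (U : Set (Set X)) : Prop where
  finite : U.Finite
  isOpen : ∀ u ∈ U, IsOpen u
  covers : ⋃₀ U = Set.univ

/-- `h_top(T, 𝒰) = lim (1/n) log N(𝒰 ∨ T⁻¹𝒰 ∨ ⋯ ∨ T^{-(n-1)}𝒰)`. It is written as a limit superior
in the extended reals; the limit exists for every finite cover, see `tendsto_coverEntropyOf`. -/
def coverEntropyOf {X : Type*} (T : X → X) (U : Set (Set X)) : EReal :=
  limsup (fun n : ℕ => ((Real.log (coverNumber (dynCover T U n)) / n : ℝ) : EReal)) atTop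

/-- The topological entropy `h_top(T)`: the supremum of `h_top(T, 𝒰)` over all finite open
covers `𝒰` of `X`. -/
def topEntropy {X : Type*} [TopologicalSpace X] (T : X → X) : EReal :=
  ⨆ (U : Set (Set X)) (_ : IsFiniteOpenCover U), coverEntropyOf T U

section EntropyLimit

variable {X : Type*}

theorem coverNumber_spec {U : Set (Set X)} (hU : U.Finite) (hc : ⋃₀ U = Set.univ) :
    ∃ F : Finset (Set X), (F : Set (Set X)) ⊆ U ∧
      ⋃₀ (F : Set (Set X)) = Set.univ ∧ F.card = coverNumber U :=
  Nat.sInf_mem (s := {m : ℕ | ∃ F : Finset (Set X), (F : Set (Set X)) ⊆ U ∧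
    ⋃₀ (F : Set (Set X)) = Set.univ ∧ F.card = m})
    ⟨hU.toFinset.card, hU.toFinset, by simp, by simpa using hc, rfl⟩

theorem coverNumber_le {U : Set (Set X)} (F : Finset (Set X)) (hF : (F : Set (Set X)) ⊆ U)
    (hc : ⋃₀ (F : Set (Set X)) = Set.univ) : coverNumber U ≤ F.card :=
  Nat.sInf_le ⟨F, hF, hc, rfl⟩

theorem coverNumber_pos [Nonempty X] {U : Set (Set X)} (hU : U.Finite) (hc : ⋃₀ U = Set.univ) :
    0 < coverNumber U := by
  obtain ⟨F, -, hF, hcard⟩ := coverNumber_spec hU hc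
  rw [← hcard, Finset.card_pos]
  obtain ⟨x⟩ := ‹Nonempty X›
  obtain ⟨u, hu, -⟩ : x ∈ ⋃₀ (F : Set (Set X)) := hF ▸ Set.mem_univ x
  exact ⟨u, hu⟩

theorem dynCover_finite (T : X → X) {U : Set (Set X)} (hU : U.Finite) :
    ∀ n, (dynCover T U n).Finite
  | 0 => Set.finite_singleton _
  | n + 1 => (dynCover_finite T hU n).image2 _ (hU.image _)

theorem coverJoin_covers {U V : Set (Set X)} (hU : ⋃₀ U = Set.univ) (hV : ⋃₀ V = Set.univ) :
    ⋃₀ coverJoin U V = Set.univ := by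
  refine Set.eq_univ_of_forall fun x => ?_
  obtain ⟨u, hu, hxu⟩ : x ∈ ⋃₀ U := hU ▸ Set.mem_univ x
  obtain ⟨v, hv, hxv⟩ : x ∈ ⋃₀ V := hV ▸ Set.mem_univ x
  exact ⟨u ∩ v, ⟨u, hu, v, hv, rfl⟩, hxu, hxv⟩

theorem coverPullback_covers (T : X → X) {U : Set (Set X)} (hU : ⋃₀ U = Set.univ) :
    ⋃₀ coverPullback T U = Set.univ := by
  refine Set.eq_univ_of_forall fun x => ?_
  obtain ⟨u, hu, hxu⟩ : T x ∈ ⋃₀ U := hU ▸ Set.mem_univ (T x)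
  exact ⟨T ⁻¹' u, ⟨u, hu, rfl⟩, hxu⟩

theorem dynCover_covers (T : X → X) {U : Set (Set X)} (hc : ⋃₀ U = Set.univ) :
    ∀ n, ⋃₀ dynCover T U n = Set.univ
  | 0 => by simp [dynCover]
  | n + 1 => coverJoin_covers (dynCover_covers T hc n) (coverPullback_covers _ hc)

theorem dynCover_add (T : X → X) (U : Set (Set X)) (m n : ℕ) :
    dynCover T U (m + n) = coverJoin (dynCover T U m) (coverPullback (T^[m]) (dynCover T U n)) := by
  induction n with
  | zero => simp [dynCover, coverJoin, coverPullback]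
  | succ n ih =>
    rw [← Nat.add_assoc, dynCover, ih, dynCover]
    ext s
    simp only [coverJoin, coverPullback, Set.mem_image2, Set.mem_image]
    constructor
    · rintro ⟨_, ⟨a, ha, _, ⟨b, hb, rfl⟩, rfl⟩, _, ⟨u, hu, rfl⟩, rfl⟩
      refine ⟨a, ha, _, ⟨_, ⟨b, hb, _, ⟨u, hu, rfl⟩, rfl⟩, rfl⟩, ?_⟩
      rw [Nat.add_comm m n, Function.iterate_add, Set.preimage_inter, Set.preimage_comp,
        Set.inter_assoc]
    · rintro ⟨a, ha, _, ⟨_, ⟨b, hb, _, ⟨u, hu, rfl⟩, rfl⟩, rfl⟩, rfl⟩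
      refine ⟨_, ⟨a, ha, _, ⟨b, hb, rfl⟩, rfl⟩, _, ⟨u, hu, rfl⟩, ?_⟩
      rw [Nat.add_comm m n, Function.iterate_add, Set.preimage_inter, Set.preimage_comp,
        Set.inter_assoc]

theorem coverNumber_dynCover_add_le (T : X → X) {U : Set (Set X)} (hU : U.Finite)
    (hc : ⋃₀ U = Set.univ) (m n : ℕ) :
    coverNumber (dynCover T U (m + n)) ≤
      coverNumber (dynCover T U m) * coverNumber (dynCover T U n) := by
  classical
  obtain ⟨F, hF, hFc, hFn⟩ := coverNumber_spec (dynCover_finite T hU m) (dynCover_covers T hc m)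
  obtain ⟨G, hG, hGc, hGn⟩ := coverNumber_spec (dynCover_finite T hU n) (dynCover_covers T hc n)
  let H : Finset (Set X) := (F ×ˢ G).image fun p => p.1 ∩ T^[m] ⁻¹' p.2
  have hH : (H : Set (Set X)) = coverJoin (F : Set (Set X)) (coverPullback (T^[m]) G) := by
    ext s
    simp only [H, coverJoin, coverPullback, Finset.coe_image, Finset.coe_product, Set.mem_image,
      Set.mem_image2, Set.mem_prod, Prod.exists]
    constructor
    · rintro ⟨a, b, ⟨ha, hb⟩, rfl⟩
      exact ⟨a, ha, _, ⟨b, hb, rfl⟩, rfl⟩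
    · rintro ⟨a, ha, _, ⟨b, hb, rfl⟩, rfl⟩
      exact ⟨a, b, ⟨ha, hb⟩, rfl⟩
  calc coverNumber (dynCover T U (m + n)) ≤ H.card := by
        refine coverNumber_le H ?_ ?_
        · rw [hH, dynCover_add]
          exact Set.image2_subset hF (Set.image_mono hG)
        · rw [hH]
          exact coverJoin_covers hFc (coverPullback_covers _ hGc)
    _ ≤ (F ×ˢ G).card := Finset.card_image_le
    _ = _ := by rw [Finset.card_product, hFn, hGn]

/-- The limit defining `h_top(T, 𝒰)` exists. -/
theorem tendsto_coverEntropyOf (T : X → X) {U : Set (Set X)} (hU : U.Finite)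
    (hc : ⋃₀ U = Set.univ) :
    Tendsto (fun n : ℕ => ((Real.log (coverNumber (dynCover T U n)) / n : ℝ) : EReal)) atTop
      (𝓝 (coverEntropyOf T U)) := by
  have hsub : Subadditive fun n : ℕ => Real.log (coverNumber (dynCover T U n)) := by
    intro m n
    have hle := coverNumber_dynCover_add_le T hU hc m n
    rcases isEmpty_or_nonempty X with hX | hX
    · have h0 : ∀ k, coverNumber (dynCover T U k) = 0 := fun k =>
        Nat.le_zero.1 (coverNumber_le ∅ (by simp) (Subsingleton.elim _ _))
      simp [h0]
    · have hp : ∀ k, 0 < coverNumber (dynCover T U k) := fun k =>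
        coverNumber_pos (dynCover_finite T hU k) (dynCover_covers T hc k)
      have hm : ((coverNumber (dynCover T U m) : ℕ) : ℝ) ≠ 0 := by exact_mod_cast (hp m).ne'
      have hn : ((coverNumber (dynCover T U n) : ℕ) : ℝ) ≠ 0 := by exact_mod_cast (hp n).ne'
      rw [← Real.log_mul hm hn]
      refine Real.log_le_log (by exact_mod_cast hp (m + n)) ?_
      exact_mod_cast hle
  have hb : BddBelow (Set.range fun n : ℕ => Real.log (coverNumber (dynCover T U n)) / n) :=
    ⟨0, by rintro _ ⟨n, rfl⟩; exact div_nonneg (Real.log_natCast_nonneg _) n.cast_nonneg⟩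
  have h := continuous_coe_real_ereal.continuousAt.tendsto.comp (hsub.tendsto_lim hb)
  have h2 : coverEntropyOf T U = _ := h.limsup_eq
  rw [h2]
  exact h

end EntropyLimit

/-! ### Quasi-states, states and the induced homeomorphisms -/

section StateSpaces

variable {A : Type*} [NonUnitalCStarAlgebra A]

/-- An automorphism of a C⋆-algebra as an isometric isomorphism of the underlying Banach space. -/
def autIsometry (α : A ≃⋆ₐ[ℂ] A) : A ≃ₗᵢ[ℂ] A where
  toFun := α
  invFun := α.symm
  left_inv := α.symm_apply_apply
  right_inv := α.apply_symm_apply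
  map_add' := map_add α
  map_smul' := map_smul α
  norm_map' := NonUnitalStarAlgHom.norm_map α α.injective

@[simp] theorem autIsometry_apply (α : A ≃⋆ₐ[ℂ] A) (a : A) : autIsometry α a = α a := rfl

/-- The weak⋆ homeomorphism `σ ↦ σ ∘ α` of the dual `A*`. -/
def dualHomeo (α : A ≃⋆ₐ[ℂ] A) : WeakDual ℂ A ≃ₜ WeakDual ℂ A where
  toFun σ := StrongDual.toWeakDual
    ((WeakDual.toStrongDual σ).comp ((autIsometry α : A ≃L[ℂ] A) : A →L[ℂ] A))
  invFun σ := StrongDual.toWeakDual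
    ((WeakDual.toStrongDual σ).comp ((autIsometry α.symm : A ≃L[ℂ] A) : A →L[ℂ] A))
  left_inv σ := DFunLike.ext _ _ fun a => congrArg σ (α.apply_symm_apply a)
  right_inv σ := DFunLike.ext _ _ fun a => congrArg σ (α.symm_apply_apply a)
  continuous_toFun := WeakDual.continuous_of_continuous_eval fun a =>
    WeakDual.eval_continuous (α a)
  continuous_invFun := WeakDual.continuous_of_continuous_eval fun a =>
    WeakDual.eval_continuous (α.symm a)

@[simp] theorem dualHomeo_apply (α : A ≃⋆ₐ[ℂ] A) (σ : WeakDual ℂ A) (a : A) :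
    dualHomeo α σ a = σ (α a) := rfl

/-- `σ` is a positive functional: `σ(a⋆a) ≥ 0` for all `a` (in particular `σ(a⋆a)` is real). -/
def IsPositiveFunctional (σ : WeakDual ℂ A) : Prop := ∀ a : A, 0 ≤ σ (star a * a)

variable (A) in
/-- The quasi-state space `Q(A)`: positive functionals of norm at most one (with the weak⋆ topology
when regarded as a subtype). -/
def quasiStateSpace : Set (WeakDual ℂ A) :=
  {σ | IsPositiveFunctional σ ∧ ‖WeakDual.toStrongDual σ‖ ≤ 1}

/-- The state space `S(A)` of a C⋆-algebra with unit `e`: positive functionals with `σ(e) = 1`. -/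
def stateSpace (e : A) : Set (WeakDual ℂ A) :=
  {σ | IsPositiveFunctional σ ∧ σ e = 1}

/-- `e` is the unit of `A`. -/
def IsAlgebraUnit (e : A) : Prop := ∀ x : A, e * x = x ∧ x * e = x

theorem isPositiveFunctional_dualHomeo_iff (α : A ≃⋆ₐ[ℂ] A) (σ : WeakDual ℂ A) :
    IsPositiveFunctional σ ↔ IsPositiveFunctional (dualHomeo α σ) := by
  constructor
  · intro h a
    simpa [map_star] using h (α a)
  · intro h a
    simpa [map_star] using h (α.symm a)

theorem norm_dualHomeo (α : A ≃⋆ₐ[ℂ] A) (σ : WeakDual ℂ A) :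
    ‖WeakDual.toStrongDual (dualHomeo α σ)‖ = ‖WeakDual.toStrongDual σ‖ :=
  ContinuousLinearMap.opNorm_comp_linearIsometryEquiv (WeakDual.toStrongDual σ) (autIsometry α)

theorem IsAlgebraUnit.map_eq {e : A} (he : IsAlgebraUnit e) (α : A ≃⋆ₐ[ℂ] A) : α e = e := by
  have h1 : α e * e = α e := (he (α e)).2
  have h2 : α e * e = e := by
    have h := congrArg α (he (α.symm e)).1
    simpa using h
  exact h1.symm.trans h2

/-- `T̃_α`: the homeomorphism `σ ↦ σ ∘ α` of the quasi-state space. -/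
def quasiStateHomeo (α : A ≃⋆ₐ[ℂ] A) : quasiStateSpace A ≃ₜ quasiStateSpace A :=
  (dualHomeo α).subtype fun σ => by
    show _ ∧ _ ↔ _ ∧ _
    rw [norm_dualHomeo, ← isPositiveFunctional_dualHomeo_iff]

/-- `T_α`: the homeomorphism `σ ↦ σ ∘ α` of the state space of a unital C⋆-algebra. -/
def stateHomeo (α : A ≃⋆ₐ[ℂ] A) {e : A} (he : IsAlgebraUnit e) :
    stateSpace e ≃ₜ stateSpace e :=
  (dualHomeo α).subtype fun σ => by
    show _ ∧ _ ↔ _ ∧ _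
    rw [dualHomeo_apply, he.map_eq, ← isPositiveFunctional_dualHomeo_iff]

end StateSpaces

/-! ### Isomorphic copies of `ℓ₁` along iterates -/

section EllOne

variable {X : Type*} [NormedAddCommGroup X] [NormedSpace ℂ X]

/-- The complex Banach space `ℓ₁^I`. -/
abbrev EllOne (I : Type*) : Type _ := lp (fun _ : I => ℂ) 1

open Classical in
/-- The standard basis element of `ℓ₁^I` associated with `i`. -/
def ellOneBasis {I : Type*} (i : I) : EllOne I := lp.single 1 i (1 : ℂ)

/-- An isomorphism of normed spaces is a `K`-isomorphism if `‖Γ‖ ‖Γ⁻¹‖ ≤ K`. -/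
def IsKIsomorphism {E F : Type*} [NormedAddCommGroup E] [NormedSpace ℂ E] [NormedAddCommGroup F]
    [NormedSpace ℂ F] (K : ℝ) (Γ : E ≃L[ℂ] F) : Prop :=
  ‖(Γ : E →L[ℂ] F)‖ * ‖(Γ.symm : F →L[ℂ] E)‖ ≤ K

/-- `I ⊆ ℤ` is an `ℓ₁` isomorphism set for `x`: it is infinite and there is an isomorphism from
`ℓ₁^I` onto the closed linear span of `{α^i(x) : i ∈ I}` that sends the standard basis element
associated with `i` to `α^i(x)`. -/
def IsEllOneIsomorphismSet (α : X ≃ₗᵢ[ℂ] X) (x : X) (I : Set ℤ) : Prop :=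
  I.Infinite ∧
    ∃ Γ : EllOne I ≃L[ℂ]
        (Submodule.span ℂ ((fun i : ℤ => (α ^ i) x) '' I)).topologicalClosure,
      ∀ i : I, (Γ (ellOneBasis i) : X) = (α ^ (i : ℤ)) x

/-- The set `J ⊆ ℤ` has density `D`: `|J ∩ {-n, …, n}| / (2n+1) → D`. -/
def HasDensity (J : Set ℤ) (D : ℝ) : Prop :=
  Tendsto (fun n : ℕ => ((J ∩ Set.Icc (-(n : ℤ)) n).ncard : ℝ) / (2 * n + 1)) atTop (𝓝 D)

/-- `x` has an `ℓ₁` isomorphism set of positive density. -/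
def HasEllOneSetOfPosDensity (α : X ≃ₗᵢ[ℂ] X) (x : X) : Prop :=
  ∃ (I : Set ℤ) (D : ℝ), 0 < D ∧ HasDensity I D ∧ IsEllOneIsomorphismSet α x I

/-- There are constants `K, d > 0`, a sequence `n_k → ∞` and sets `I_k ⊆ {0, …, n_k - 1}` with
`|I_k| ≥ d n_k` such that, for every `k`, the linear map `ℓ₁^{I_k} → span {α^i(x) : i ∈ I_k}`
sending the standard basis element associated with `i` to `α^i(x)` is a `K`-isomorphism. -/
def HasProportionalEllOneIterates (α : X ≃ₗᵢ[ℂ] X) (x : X) : Prop :=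
  ∃ (K d : ℝ) (n : ℕ → ℕ) (I : ℕ → Finset ℕ), 0 < K ∧ 0 < d ∧ Tendsto n atTop atTop ∧
    ∀ k : ℕ, I k ⊆ Finset.range (n k) ∧ d * (n k : ℝ) ≤ ((I k).card : ℝ) ∧
      ∃ Γ : EllOne (I k) ≃L[ℂ]
          Submodule.span ℂ ((fun i : ℕ => (α ^ i) x) '' (I k : Set ℕ)),
        (∀ i : I k, (Γ (ellOneBasis i) : X) = (α ^ (i : ℕ)) x) ∧ IsKIsomorphism K Γ

end EllOne

end

/-!
Infinite entropy produces an element with proportionally large copies of `ℓ₁` along its iterates;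
the same element then has an `ℓ₁` isomorphism set of positive density, and conversely; and such
copies of `ℓ₁` force infinite entropy. The state space runs parallel to the quasi-state space.

*Positive entropy gives copies of `ℓ₁`.* The real evaluations at a total set of self-adjoint
elements separate the points of the compact space `Q(A)`, so a cover of positive entropy is refined,
up to a product of finitely many covers, by the pull-backs of fine interval covers under such
evaluations; hence one evaluation at some `a` already has itineraries of exponential complexity.
Reading an itinerary as a word over a finite alphabet of levels, exponential complexity in the
uniform sense passes to exponentially many words which are pairwise separated on a fixed proportion
of the coordinates, because Hamming balls of small proportional radius have small growth
(`exists_radius_card_hammingBall_le`). Such a family shatters at least a power of its cardinality of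
patterns, by repeatedly splitting it along a popular coordinate
(`two_pow_le_card_shatteredPatterns`), and so it must shatter a pattern supported on a positive
proportion of the times (`exists_isShattered_of_exp_le`). Choosing the high or the low level
according to the signs of given coefficients `bᵢ` produces two quasi-states whose difference is
at least `ε ∑ |bᵢ|` on `∑ bᵢ αⁱ(a)`, which is the lower `ℓ₁` bound. Only positivity of the entropy
is used.

*Copies of `ℓ₁` give infinite entropy.* Every self-adjoint element is normed up to a constant by a
difference of two quasi-states, by the Hahn–Banach theorem for the distance to the negative cone
(`exists_quasiState_re_eq`). Separation in `ℂ^I` then shows that every function `I → ℂ` bounded by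
one is attained on the `αⁱ(a)` by a combination of four quasi-states with bounded coefficients
(`exists_quasiStates_interpolating`). Counting functions with `m` levels bounds the entropy below
by a multiple of `log m` (`topEntropy_eq_top_of_interpolation`). In the unital case, quasi-states
are multiples of states.

*Proportional copies and sets of positive density.* The finite sets of integers satisfying an `ℓ₁`
bound with a given constant form a hereditary translation-invariant family. The maximal cardinality
of a member in a window of length `n` is subadditive in `n`, with a rate `D`; translating nearly
optimal members to a good starting point and passing to an ultrafilter limit gives a set of
nonnegative integers of one-sided density `D` (`exists_hasDensity_of_frequently`), hence of
symmetric density `D / 2`.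
-/

/-! ### Hamming balls and shattered patterns -/

section Shattering

theorem card_hammingBall_mul_pow_le {ι β : Type*} [Fintype ι] [DecidableEq ι] [Fintype β]
    [DecidableEq β] (v : ℕ) (b : ι → β) {x : ℝ} (hx0 : 0 < x) (hx1 : x ≤ 1) :
    ((Finset.univ.filter fun p : ι → β => hammingDist p b ≤ v).card : ℝ) * x ^ v ≤
      (1 + Fintype.card β * x) ^ Fintype.card ι := by
  -- the generating function of the Hamming distance to `b` is a product over the coordinates
  have hgen : ∑ p : ι → β, x ^ hammingDist p b = ∏ i : ι, ∑ c : β, if c ≠ b i then x else 1 := by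
    rw [Finset.prod_univ_sum, Fintype.piFinset_univ]
    refine Finset.sum_congr rfl fun p _ => ?_
    rw [Finset.prod_ite]
    simp [hammingDist]
  calc _ = ∑ p ∈ Finset.univ.filter fun p : ι → β => hammingDist p b ≤ v, x ^ v := by simp
    _ ≤ ∑ p ∈ Finset.univ.filter fun p : ι → β => hammingDist p b ≤ v, x ^ hammingDist p b :=
        Finset.sum_le_sum fun p hp =>
          pow_le_pow_of_le_one hx0.le hx1 (Finset.mem_filter.1 hp).2
    _ ≤ ∑ p : ι → β, x ^ hammingDist p b :=
        Finset.sum_le_sum_of_subset_of_nonneg (Finset.filter_subset _ _)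
          fun _ _ _ => by positivity
    _ = ∏ i : ι, ∑ c : β, if c ≠ b i then x else 1 := hgen
    _ ≤ ∏ i : ι, (1 + Fintype.card β * x) := by
        refine Finset.prod_le_prod (fun i _ => Finset.sum_nonneg fun c _ => ?_) fun i _ => ?_
        · split_ifs <;> positivity
        · calc ∑ c : β, (if c ≠ b i then x else 1)
              ≤ ∑ c : β, ((if c = b i then 1 else 0) + x) := by
                refine Finset.sum_le_sum fun c _ => ?_
                by_cases h : c = b i <;> simp [h, hx0.le]
            _ = 1 + Fintype.card β * x := by simp [Finset.sum_add_distrib]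
    _ = _ := by simp

/-- Hamming balls of a sufficiently small proportional radius have arbitrarily small exponential
growth rate. -/
theorem exists_radius_card_hammingBall_le (K : ℕ) {c : ℝ} (hc : 0 < c) :
    ∃ d : ℝ, 0 < d ∧ d ≤ 1 ∧ ∀ (n : ℕ) (β : Type) [Fintype β] [DecidableEq β],
      Fintype.card β = K → ∀ b : Fin n → β,
        ((Finset.univ.filter fun p : Fin n → β => hammingDist p b ≤ ⌊d * n⌋₊).card : ℝ) ≤
          Real.exp (c * n) := by
  set x : ℝ := min 1 (c / (2 * (K + 1))) with hx
  have hx0 : 0 < x := lt_min one_pos (by positivity)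
  have hx1 : x ≤ 1 := min_le_left _ _
  have hKx : K * x ≤ c / 2 := by
    have h : x ≤ c / (2 * (K + 1)) := min_le_right _ _
    rw [le_div_iff₀ (by positivity)] at h
    nlinarith
  have hlog : 0 ≤ -Real.log x := by linarith [Real.log_nonpos hx0.le hx1]
  set d : ℝ := min 1 (c / (2 * (-Real.log x + 1))) with hd
  have hd0 : 0 < d := lt_min one_pos (by positivity)
  have hdl : d * -Real.log x ≤ c / 2 := by
    have h : d ≤ c / (2 * (-Real.log x + 1)) := min_le_right _ _
    rw [le_div_iff₀ (by positivity)] at h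
    nlinarith
  refine ⟨d, hd0, min_le_left _ _, fun n β _ _ hβ b => ?_⟩
  have h1 := card_hammingBall_mul_pow_le ⌊d * n⌋₊ b hx0 hx1
  rw [hβ, Fintype.card_fin] at h1
  have h2 : (1 + K * x) ^ n ≤ Real.exp (c / 2 * n) := by
    calc (1 + K * x) ^ n ≤ (Real.exp (c / 2)) ^ n := by
          refine pow_le_pow_left₀ (by positivity) ?_ n
          linarith [Real.add_one_le_exp (c / 2)]
      _ = _ := by rw [← Real.exp_nat_mul, mul_comm]
  have h3 : Real.exp (-(c / 2 * n)) ≤ x ^ ⌊d * n⌋₊ := by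
    conv_rhs => rw [← Real.exp_log hx0, ← Real.exp_nat_mul]
    refine Real.exp_le_exp.2 ?_
    have h4 : (⌊d * n⌋₊ : ℝ) ≤ d * n := Nat.floor_le (by positivity)
    have h5 : (0 : ℝ) ≤ n := n.cast_nonneg
    nlinarith
  set N : ℝ := ((Finset.univ.filter fun p : Fin n → β => hammingDist p b ≤ ⌊d * n⌋₊).card : ℝ)
  have h6 : N * Real.exp (-(c / 2 * n)) ≤ Real.exp (c / 2 * n) :=
    (mul_le_mul_of_nonneg_left h3 (Nat.cast_nonneg _)).trans (h1.trans h2)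
  rw [Real.exp_neg, ← div_eq_mul_inv, div_le_iff₀ (Real.exp_pos _), ← Real.exp_add] at h6
  refine h6.trans (le_of_eq ?_)
  congr 1
  ring

/-- A pattern `ρ` assigns to some coordinates an ordered pair of `sep`-separated values. It is
shattered by the set of words `S` if every way of choosing one of the two values at each of these
coordinates is realised by a word in `S`. -/
def IsShattered {ι C : Type*} (sep : C → C → Prop) (S : Finset (ι → C))
    (ρ : ι → Option (C × C)) : Prop :=
  (∀ i pq, ρ i = some pq → sep pq.1 pq.2) ∧
    ∀ J : Set ι, ∃ s ∈ S, ∀ i pq, ρ i = some pq → (i ∈ J → s i = pq.1) ∧ (i ∉ J → s i = pq.2)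

theorem IsShattered.mono {ι C : Type*} {sep : C → C → Prop} {S S' : Finset (ι → C)}
    (h : S ⊆ S') {ρ : ι → Option (C × C)} (hρ : IsShattered sep S ρ) : IsShattered sep S' ρ :=
  ⟨hρ.1, fun J => let ⟨s, hs, hs'⟩ := hρ.2 J; ⟨s, h hs, hs'⟩⟩

variable {ι C : Type*} [Fintype ι] [Fintype C] {sep : C → C → Prop}

open Classical in
/-- The set of all patterns shattered by `S`. -/
noncomputable def shatteredPatterns (sep : C → C → Prop) (S : Finset (ι → C)) :
    Finset (ι → Option (C × C)) :=
  Finset.univ.filter (IsShattered sep S)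

theorem mem_shatteredPatterns {S : Finset (ι → C)} {ρ : ι → Option (C × C)} :
    ρ ∈ shatteredPatterns sep S ↔ IsShattered sep S ρ := by
  simp [shatteredPatterns]

open Classical in
/-- Splitting along a coordinate `i` at two separated values: a pattern shattered by both halves
gives, besides itself, its extension to the coordinate `i`. -/
theorem card_shatteredPatterns_add_le (hirr : ∀ p, ¬ sep p p) (S : Finset (ι → C)) (i : ι)
    {p q : C} (hpq : sep p q) :
    (shatteredPatterns sep (S.filter fun s => s i = p)).card +
      (shatteredPatterns sep (S.filter fun s => s i = q)).card ≤
      (shatteredPatterns sep S).card := by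
  set T₁ := shatteredPatterns sep (S.filter fun s => s i = p)
  set T₂ := shatteredPatterns sep (S.filter fun s => s i = q)
  -- `i` is not in the support of a pattern shattered by words that are constant at `i`
  have hnone : ∀ (r : C) (ρ : ι → Option (C × C)),
      IsShattered sep (S.filter fun s => s i = r) ρ → ρ i = none := by
    intro r ρ hρ
    by_contra hne
    obtain ⟨pq, h⟩ := Option.ne_none_iff_exists'.1 hne
    obtain ⟨s, hs, hs'⟩ := hρ.2 Set.univ
    obtain ⟨t, ht, ht'⟩ := hρ.2 ∅
    have e1 := (hs' i pq h).1 (Set.mem_univ i)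
    have e2 := (ht' i pq h).2 (Set.notMem_empty i)
    have e3 := hρ.1 i pq h
    rw [← e1, ← e2, (Finset.mem_filter.1 hs).2, (Finset.mem_filter.1 ht).2] at e3
    exact hirr _ e3
  let ext : (ι → Option (C × C)) → (ι → Option (C × C)) := fun ρ =>
    Function.update ρ i (some (p, q))
  have hinj : Set.InjOn ext (T₁ ∩ T₂ : Finset _) := by
    intro ρ hρ ρ' hρ' h
    have h1 := hnone p ρ (mem_shatteredPatterns.1 (Finset.mem_inter.1 hρ).1)
    have h2 := hnone p ρ' (mem_shatteredPatterns.1 (Finset.mem_inter.1 hρ').1)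
    funext j
    by_cases hj : j = i
    · rw [hj, h1, h2]
    · have := congrFun h j
      simpa [ext, hj] using this
  have hdisj : Disjoint (T₁ ∪ T₂) ((T₁ ∩ T₂).image ext) := by
    rw [Finset.disjoint_left]
    rintro ρ hρ hρ'
    obtain ⟨ρ', -, rfl⟩ := Finset.mem_image.1 hρ'
    have : ext ρ' i = none := by
      rcases Finset.mem_union.1 hρ with h | h
      · exact hnone p _ (mem_shatteredPatterns.1 h)
      · exact hnone q _ (mem_shatteredPatterns.1 h)
    simp [ext] at this
  calc T₁.card + T₂.card = (T₁ ∪ T₂).card + (T₁ ∩ T₂).card :=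
        (Finset.card_union_add_card_inter _ _).symm
    _ = ((T₁ ∪ T₂) ∪ (T₁ ∩ T₂).image ext).card := by
        rw [Finset.card_union_of_disjoint hdisj, Finset.card_image_of_injOn hinj]
    _ ≤ _ := by
        refine Finset.card_le_card fun ρ hρ => mem_shatteredPatterns.2 ?_
        rcases Finset.mem_union.1 hρ with h | h
        · rcases Finset.mem_union.1 h with h | h
          · exact (mem_shatteredPatterns.1 h).mono (Finset.filter_subset _ _)
          · exact (mem_shatteredPatterns.1 h).mono (Finset.filter_subset _ _)
        · obtain ⟨ρ', hρ', rfl⟩ := Finset.mem_image.1 h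
          have h1 := mem_shatteredPatterns.1 (Finset.mem_inter.1 hρ').1
          have h2 := mem_shatteredPatterns.1 (Finset.mem_inter.1 hρ').2
          refine ⟨fun j pq hj => ?_, fun J => ?_⟩
          · by_cases hji : j = i
            · subst hji
              simp only [ext, Function.update_self, Option.some.injEq] at hj
              subst hj
              exact hpq
            · exact h1.1 j pq (by simpa [ext, hji] using hj)
          · by_cases hiJ : i ∈ J
            · obtain ⟨s, hs, hs'⟩ := h1.2 J
              refine ⟨s, (Finset.mem_filter.1 hs).1, fun j pq hj => ?_⟩
              by_cases hji : j = i
              · subst hji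
                simp only [ext, Function.update_self, Option.some.injEq] at hj
                subst hj
                exact ⟨fun _ => (Finset.mem_filter.1 hs).2, fun h => absurd hiJ h⟩
              · exact hs' j pq (by simpa [ext, hji] using hj)
            · obtain ⟨s, hs, hs'⟩ := h2.2 J
              refine ⟨s, (Finset.mem_filter.1 hs).1, fun j pq hj => ?_⟩
              by_cases hji : j = i
              · subst hji
                simp only [ext, Function.update_self, Option.some.injEq] at hj
                subst hj
                exact ⟨fun h => absurd h hiJ, fun _ => (Finset.mem_filter.1 hs).2⟩
              · exact hs' j pq (by simpa [ext, hji] using hj)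

open Classical in
/-- If any two words of `S` are separated on a proportion `η` of the coordinates, then for some
coordinate and some pair of separated values, each value is taken on a fixed proportion of `S`. -/
theorem exists_popular_separated_values [Nonempty ι] {η : ℝ} (hη : 0 < η)
    (S : Finset (ι → C)) (hS : (2 : ℝ) ≤ S.card)
    (hsep : ∀ s ∈ S, ∀ t ∈ S, s ≠ t →
      η * Fintype.card ι ≤ (Finset.univ.filter fun i => sep (s i) (t i)).card) :
    ∃ (i : ι) (p q : C), sep p q ∧
      (S.card : ℝ) / (2 * (Fintype.card C) ^ 2 / η) ≤ (S.filter fun s => s i = p).card ∧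
      (S.card : ℝ) / (2 * (Fintype.card C) ^ 2 / η) ≤ (S.filter fun s => s i = q).card := by
  set n : ℝ := (Fintype.card ι : ℝ) with hn
  have hn0 : 0 < n := by rw [hn]; exact_mod_cast Fintype.card_pos
  set k : ℝ := (Fintype.card C : ℝ) with hk
  have hk0 : 0 < k := by
    obtain ⟨s, hs⟩ : S.Nonempty := Finset.card_pos.1 (by
      have : (0 : ℝ) < S.card := by linarith
      exact_mod_cast this)
    rw [hk]
    exact_mod_cast Fintype.card_pos_iff.2 ⟨s (Classical.arbitrary ι)⟩
  set N : ℝ := (S.card : ℝ) with hN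
  let f : ι × C × C → ℝ := fun z => if sep z.2.1 z.2.2 then
    ((S.filter fun s => s z.1 = z.2.1).card : ℝ) * (S.filter fun s => s z.1 = z.2.2).card else 0
  -- double counting of the triples `(s, t, i)` such that `s` and `t` are separated at `i`
  have hdc : ∑ z, f z =
      ∑ s ∈ S, ∑ t ∈ S, ((Finset.univ.filter fun i => sep (s i) (t i)).card : ℝ) := by
    let g : (ι → C) → (ι → C) → ι × C × C → ℝ := fun s t z => if s z.1 = z.2.1 then
      (if t z.1 = z.2.2 then (if sep z.2.1 z.2.2 then 1 else 0) else 0) else 0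
    have h1 : ∀ z, f z = ∑ s ∈ S, ∑ t ∈ S, g s t z := by
      rintro ⟨i, p, q⟩
      simp only [f, g]
      by_cases h : sep p q
      · simp [h, ← Finset.sum_filter]
      · simp [h]
    have h2 : ∀ s t : ι → C, ((Finset.univ.filter fun i => sep (s i) (t i)).card : ℝ) =
        ∑ z, g s t z := by
      intro s t
      simp [g, Fintype.sum_prod_type]
    simp only [h1, h2]
    rw [Finset.sum_comm]
    exact Finset.sum_congr rfl fun s _ => Finset.sum_comm
  have hlow : n * k ^ 2 * (η * N ^ 2 / (2 * k ^ 2)) ≤ ∑ z, f z := by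
    rw [hdc]
    calc n * k ^ 2 * (η * N ^ 2 / (2 * k ^ 2)) = η * n * (N * N / 2) := by field_simp
      _ ≤ η * n * (N * N - N) := by
          refine mul_le_mul_of_nonneg_left ?_ (by positivity)
          nlinarith
      _ = ∑ s ∈ S, ∑ t ∈ S, if s = t then 0 else η * n := by
          have : ∀ s ∈ S, (∑ t ∈ S, if s = t then 0 else η * n) = N * (η * n) - η * n := by
            intro s hs
            have h4 : ∀ t, (if s = t then 0 else η * n) = η * n - if s = t then η * n else 0 := by
              intro t; split_ifs <;> simp
            simp [h4, Finset.sum_sub_distrib, hs, hN]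
          rw [Finset.sum_congr rfl this]
          simp only [Finset.sum_const, nsmul_eq_mul, ← hN]
          ring
      _ ≤ _ := by
          refine Finset.sum_le_sum fun s hs => Finset.sum_le_sum fun t ht => ?_
          split_ifs with h
          · positivity
          · exact hsep s hs t ht h
  have hcard : ∑ z : ι × C × C, (η * N ^ 2 / (2 * k ^ 2)) =
      n * k ^ 2 * (η * N ^ 2 / (2 * k ^ 2)) := by
    simp [hn, hk]
    ring_nf
    simp
  have hN0 : 0 < N := by linarith
  obtain ⟨⟨i, p, q⟩, -, hz⟩ := Finset.exists_le_of_sum_le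
    (s := (Finset.univ : Finset (ι × C × C))) (f := fun _ => η * N ^ 2 / (2 * k ^ 2)) (g := f)
    (by
      have hC : Nonempty C := Fintype.card_pos_iff.1 (by rw [hk] at hk0; exact_mod_cast hk0)
      exact Finset.univ_nonempty) (by rw [hcard]; exact hlow)
  have hpos : 0 < f (i, p, q) := lt_of_lt_of_le (by positivity) hz
  have hpq : sep p q := by
    by_contra h
    simp [f, h] at hpos
  refine ⟨i, p, q, hpq, ?_, ?_⟩
  all_goals
    simp only [f, hpq, if_true] at hz
    have hp : ((S.filter fun s => s i = p).card : ℝ) ≤ N := by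
      rw [hN]; exact_mod_cast Finset.card_filter_le _ _
    have hq : ((S.filter fun s => s i = q).card : ℝ) ≤ N := by
      rw [hN]; exact_mod_cast Finset.card_filter_le _ _
    have e : N / (2 * k ^ 2 / η) * N = η * N ^ 2 / (2 * k ^ 2) := by field_simp
    refine le_of_mul_le_mul_right (a := N) ?_ hN0
    rw [e]
  · exact hz.trans (mul_le_mul_of_nonneg_left hq (Nat.cast_nonneg _))
  · exact hz.trans ((mul_comm _ _).trans_le (mul_le_mul_of_nonneg_left hp (Nat.cast_nonneg _)))

/-- A family of words that are pairwise separated on a fixed proportion of the coordinates shatters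
a number of patterns that is a power of its cardinality. -/
theorem two_pow_le_card_shatteredPatterns [Nonempty ι] [Nonempty C] (hirr : ∀ p, ¬ sep p p) {η : ℝ}
    (hη : 0 < η) (hη1 : η ≤ 1) (m : ℕ) (S : Finset (ι → C))
    (hcard : (2 * (Fintype.card C : ℝ) ^ 2 / η) ^ m ≤ S.card)
    (hsep : ∀ s ∈ S, ∀ t ∈ S, s ≠ t → η * Fintype.card ι ≤
      (Set.ncard {i | sep (s i) (t i)} : ℝ)) :
    2 ^ m ≤ (shatteredPatterns sep S).card := by
  classical
  induction m generalizing S with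
  | zero =>
    rw [pow_zero] at hcard ⊢
    obtain ⟨s, hs⟩ : S.Nonempty := Finset.card_pos.1 (by
      have : (0 : ℝ) < S.card := by linarith
      exact_mod_cast this)
    exact Finset.card_pos.2
      ⟨fun _ => none, mem_shatteredPatterns.2 ⟨by simp, fun _ => ⟨s, hs, by simp⟩⟩⟩
  | succ m ih =>
    have hk : (1 : ℝ) ≤ Fintype.card C := by exact_mod_cast Fintype.card_pos
    have hL : 2 ≤ 2 * (Fintype.card C : ℝ) ^ 2 / η := by
      rw [le_div_iff₀ hη]
      nlinarith
    set L := 2 * (Fintype.card C : ℝ) ^ 2 / η with hLdef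
    have hLm : 1 ≤ L ^ m := one_le_pow₀ (by linarith)
    have h2 : (2 : ℝ) ≤ S.card := by
      rw [pow_succ] at hcard
      nlinarith
    obtain ⟨i, p, q, hpq, hp, hq⟩ := exists_popular_separated_values (sep := sep) hη S h2
      (fun s hs t ht hst => by
        refine (hsep s hs t ht hst).trans (le_of_eq ?_)
        rw [Set.ncard_eq_toFinset_card']
        simp)
    have hdiv : L ^ m ≤ S.card / L := by
      rw [le_div_iff₀ (by linarith), ← pow_succ]
      exact hcard
    have h3 := card_shatteredPatterns_add_le hirr S i hpq
    have h4 := ih (S.filter fun s => s i = p) (hdiv.trans hp) (fun s hs t ht =>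
      hsep s (Finset.mem_filter.1 hs).1 t (Finset.mem_filter.1 ht).1)
    have h5 := ih (S.filter fun s => s i = q) (hdiv.trans hq) (fun s hs t ht =>
      hsep s (Finset.mem_filter.1 hs).1 t (Finset.mem_filter.1 ht).1)
    rw [pow_succ]
    omega

end Shattering

section LargeShattered

/-- Linear-size shattering: if the words in `S` cannot be approximated coordinatewise, up to
non-separated values, by fewer than `exp (c n)` words, then `S` shatters a pattern whose support is
a fixed proportion of the coordinates. -/
theorem exists_isShattered_of_exp_le {C : Type} [Fintype C] [Nonempty C] {sep : C → C → Prop}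
    (hirr : ∀ p, ¬ sep p p) (hsymm : ∀ p q, sep p q → sep q p) {c : ℝ} (hc : 0 < c) :
    ∃ d : ℝ, 0 < d ∧ ∃ n₀ : ℕ, ∀ n ≥ n₀, ∀ S : Finset (Fin n → C),
      (∀ G : Finset (Fin n → C), (∀ s ∈ S, ∃ p ∈ G, ∀ i, ¬ sep (p i) (s i)) →
        Real.exp (c * n) ≤ G.card) →
      ∃ ρ, IsShattered sep S ρ ∧ d * n ≤ (Set.ncard {i | ρ i ≠ none} : ℝ) := by
  classical
  obtain ⟨η, hη, hη1, hball⟩ :=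
    exists_radius_card_hammingBall_le (Fintype.card C) (c := c / 2) (by positivity)
  set L : ℝ := 2 * (Fintype.card C : ℝ) ^ 2 / η with hL
  have hL2 : 2 ≤ L := by
    have hk : (1 : ℝ) ≤ Fintype.card C := by exact_mod_cast Fintype.card_pos
    rw [hL, le_div_iff₀ hη]
    nlinarith
  have hlogL : 0 < Real.log L := Real.log_pos (by linarith)
  have hlog2 : 0 < Real.log 2 := Real.log_pos (by norm_num)
  set c' : ℝ := c / 2 / Real.log L * Real.log 2 with hc'
  have hc'0 : 0 < c' := by positivity
  obtain ⟨d, hd, -, hball'⟩ :=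
    exists_radius_card_hammingBall_le (Fintype.card (Option (C × C))) (c := c' / 2) (by positivity)
  refine ⟨d, hd, ⌈2 / c'⌉₊ + 1, fun n hn S hS => ?_⟩
  have hn0 : 0 < n := by omega
  have hnr : 2 < c' * n := by
    have h1 : 2 / c' < n := (Nat.le_ceil _).trans_lt (by exact_mod_cast hn)
    rwa [div_lt_iff₀ hc'0, mul_comm] at h1
  have : Nonempty (Fin n) := ⟨⟨0, hn0⟩⟩
  -- a maximal subfamily of words that are pairwise separated on many coordinates
  let v := ⌊η * n⌋₊
  let P := S.powerset.filter fun R => ∀ s ∈ R, ∀ t ∈ R, s ≠ t →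
    v < (Finset.univ.filter fun i => sep (s i) (t i)).card
  obtain ⟨R, hRP, hRmax⟩ := Finset.exists_max_image P Finset.card
    ⟨∅, by simp [P]⟩
  obtain ⟨hRS, hRsep⟩ : R ⊆ S ∧ ∀ s ∈ R, ∀ t ∈ R, s ≠ t →
      v < (Finset.univ.filter fun i => sep (s i) (t i)).card := by
    simpa [P] using hRP
  have hnear : ∀ s ∈ S, ∃ t ∈ R, (Finset.univ.filter fun i => sep (t i) (s i)).card ≤ v := by
    intro s hs
    by_contra! hcon
    have hsR : s ∉ R := fun h => by
      have := hcon s h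
      simp [hirr] at this
    have hsymm' : ∀ t : Fin n → C, (Finset.univ.filter fun i => sep (s i) (t i)) =
        Finset.univ.filter fun i => sep (t i) (s i) := fun t =>
      Finset.filter_congr fun i _ => ⟨hsymm _ _, hsymm _ _⟩
    have hmem : insert s R ∈ P := by
      simp only [P, Finset.mem_filter, Finset.mem_powerset]
      refine ⟨Finset.insert_subset hs hRS, fun a ha b hb hab => ?_⟩
      rcases Finset.mem_insert.1 ha with rfl | ha' <;> rcases Finset.mem_insert.1 hb with rfl | hb'
      · exact absurd rfl hab
      · rw [hsymm']; exact hcon b hb'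
      · exact hcon a ha'
      · exact hRsep a ha' b hb' hab
    have := hRmax _ hmem
    rw [Finset.card_insert_of_notMem hsR] at this
    omega
  -- the Hamming balls around the subfamily approximate all words
  let G := R.biUnion fun t => Finset.univ.filter fun p : Fin n → C => hammingDist p t ≤ v
  have hG : Real.exp (c * n) ≤ G.card := by
    refine hS G fun s hs => ?_
    obtain ⟨t, ht, hts⟩ := hnear s hs
    refine ⟨fun i => if sep (t i) (s i) then s i else t i, ?_, fun i => ?_⟩
    · simp only [G, Finset.mem_biUnion, Finset.mem_filter, Finset.mem_univ, true_and]
      refine ⟨t, ht, le_trans (Finset.card_le_card ?_) hts⟩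
      intro i hi
      by_contra h
      simp only [Finset.mem_filter, Finset.mem_univ, true_and] at hi h
      simp [h] at hi
    · dsimp only
      split_ifs with h
      · exact hirr _
      · exact h
  have hGle : (G.card : ℝ) ≤ R.card * Real.exp (c / 2 * n) := by
    calc (G.card : ℝ) ≤ ∑ t ∈ R,
          ((Finset.univ.filter fun p : Fin n → C => hammingDist p t ≤ v).card : ℝ) := by
          exact_mod_cast Finset.card_biUnion_le
      _ ≤ ∑ t ∈ R, Real.exp (c / 2 * n) := Finset.sum_le_sum fun t _ => hball n C rfl t
      _ = _ := by simp
  have hR : Real.exp (c / 2 * n) ≤ R.card := by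
    have h1 : Real.exp (c / 2 * n) * Real.exp (c / 2 * n) ≤ R.card * Real.exp (c / 2 * n) := by
      rw [← Real.exp_add]
      refine le_trans (le_of_eq ?_) (hG.trans hGle)
      congr 1
      ring
    exact le_of_mul_le_mul_right h1 (Real.exp_pos _)
  set m := ⌊c / 2 * n / Real.log L⌋₊ with hm
  have hLm : L ^ m ≤ R.card := by
    refine le_trans ?_ hR
    rw [← Real.exp_log (show (0 : ℝ) < L by linarith), ← Real.exp_nat_mul,
      Real.exp_le_exp, ← le_div_iff₀ hlogL]
    exact Nat.floor_le (by positivity)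
  have h2m := two_pow_le_card_shatteredPatterns hirr hη hη1 m R hLm fun s hs t ht hst => by
    have h1 := hRsep s hs t ht hst
    have h2 : η * n < (Finset.univ.filter fun i => sep (s i) (t i)).card :=
      (Nat.floor_lt (by positivity)).1 h1
    rw [Set.ncard_eq_toFinset_card']
    simpa using h2.le
  by_contra! hcon
  -- otherwise all shattered patterns lie in a small Hamming ball around the empty pattern
  have hsub : shatteredPatterns sep R ⊆ Finset.univ.filter fun p : Fin n → Option (C × C) =>
      hammingDist p (fun _ => none) ≤ ⌊d * n⌋₊ := by
    intro ρ hρ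
    have h1 := hcon ρ ((mem_shatteredPatterns.1 hρ).mono hRS)
    rw [Finset.mem_filter]
    refine ⟨Finset.mem_univ _, Nat.le_floor (le_trans (le_of_eq ?_) h1.le)⟩
    rw [Set.ncard_eq_toFinset_card']
    simp [hammingDist]
  have h3 : (2 : ℝ) ^ m ≤ Real.exp (c' / 2 * n) := by
    refine le_trans ?_ (hball' n _ rfl fun _ => none)
    exact_mod_cast h2m.trans (Finset.card_le_card hsub)
  have h4 : Real.exp (c' * n) ≤ 2 * 2 ^ m := by
    rw [← pow_succ', ← Real.exp_log (show (0 : ℝ) < 2 by norm_num), ← Real.exp_nat_mul,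
      Real.exp_le_exp]
    have h5 : c / 2 * n / Real.log L ≤ (m + 1 : ℕ) := by
      push_cast
      exact (Nat.lt_floor_add_one _).le
    calc c' * n = c / 2 * n / Real.log L * Real.log 2 := by rw [hc']; ring
      _ ≤ _ := mul_le_mul_of_nonneg_right h5 hlog2.le
  have h6 : Real.exp (c' / 2 * n) ≤ 2 := by
    have h7 : Real.exp (c' / 2 * n) * Real.exp (c' / 2 * n) ≤ 2 * Real.exp (c' / 2 * n) := by
      rw [← Real.exp_add]
      refine le_trans (le_of_eq ?_) (h4.trans (mul_le_mul_of_nonneg_left h3 zero_le_two))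
      congr 1
      ring
    exact le_of_mul_le_mul_right h7 (Real.exp_pos _)
  have h8 := Real.add_one_le_exp (c' / 2 * n)
  linarith

end LargeShattered

/-! ### Open covers and iterates -/

section Covers

variable {X : Type*}

theorem mem_dynCover_iff {T : X → X} {U : Set (Set X)} {n : ℕ} {s : Set X} :
    s ∈ dynCover T U n ↔
      ∃ p : ℕ → Set X, (∀ i < n, p i ∈ U) ∧ s = {x | ∀ i < n, T^[i] x ∈ p i} := by
  induction n generalizing s with
  | zero => simp [dynCover]
  | succ n ih =>
    simp only [dynCover, coverJoin, coverPullback, Set.mem_image2, Set.mem_image]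
    constructor
    · rintro ⟨a, ha, _, ⟨u, hu, rfl⟩, rfl⟩
      obtain ⟨p, hp, rfl⟩ := ih.1 ha
      refine ⟨Function.update p n u, fun i hi => ?_, ?_⟩
      · rcases Nat.lt_succ_iff_lt_or_eq.1 hi with h | rfl
        · rw [Function.update_of_ne h.ne]
          exact hp i h
        · simpa using hu
      · ext x
        simp only [Set.mem_inter_iff, Set.mem_ofPred_eq, Set.mem_preimage, Nat.lt_succ_iff_lt_or_eq]
        constructor
        · rintro ⟨h1, h2⟩ i (h | rfl)
          · rw [Function.update_of_ne h.ne]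
            exact h1 i h
          · simpa using h2
        · intro h
          refine ⟨fun i hi => ?_, by simpa using h n (Or.inr rfl)⟩
          simpa [Function.update_of_ne hi.ne] using h i (Or.inl hi)
    · rintro ⟨p, hp, rfl⟩
      refine ⟨_, ih.2 ⟨p, fun i hi => hp i (hi.trans n.lt_succ_self), rfl⟩, _,
        ⟨p n, hp n n.lt_succ_self, rfl⟩, ?_⟩
      ext x
      simp only [Set.mem_inter_iff, Set.mem_ofPred_eq, Set.mem_preimage, Nat.lt_succ_iff_lt_or_eq]
      constructor
      · rintro ⟨h1, h2⟩ i (h | rfl)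
        · exact h1 i h
        · exact h2
      · exact fun h => ⟨fun i hi => h i (Or.inl hi), h n (Or.inr rfl)⟩

/-- If every class of points not distinguished by the covers `V w`, `w ∈ F`, lies in a single
member of `U`, then `U` is dynamically no finer than the covers `V w` together. -/
theorem coverNumber_dynCover_le_prod (T : X → X) {U : Set (Set X)} {ι : Type*} (F : Finset ι)
    (V : ι → Set (Set X)) (hV : ∀ w ∈ F, (V w).Finite) (hVc : ∀ w ∈ F, ⋃₀ V w = Set.univ)
    (h : ∀ x, ∃ u ∈ U, ∀ y, (∀ w ∈ F, ∃ v ∈ V w, x ∈ v ∧ y ∈ v) → y ∈ u) (n : ℕ) :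
    coverNumber (dynCover T U n) ≤ ∏ w ∈ F, coverNumber (dynCover T (V w) n) := by
  classical
  have hspec : ∀ w, ∃ G : Finset (Set X), w ∈ F → ((G : Set (Set X)) ⊆ dynCover T (V w) n ∧
      ⋃₀ (G : Set (Set X)) = Set.univ ∧ G.card = coverNumber (dynCover T (V w) n)) := by
    intro w
    by_cases hw : w ∈ F
    · obtain ⟨G, hG⟩ := coverNumber_spec (dynCover_finite T (hV w hw) n)
        (dynCover_covers T (hVc w hw) n)
      exact ⟨G, fun _ => hG⟩
    · exact ⟨∅, fun h => absurd h hw⟩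
  choose G hG using hspec
  choose u huU hu using h
  let code : X → (w : ι) → w ∈ F → Set X := fun x w hw =>
    (show ∃ s ∈ G w, x ∈ s by
      have := Set.mem_univ x
      rw [← (hG w hw).2.1] at this
      exact this).choose
  have hcode : ∀ x w hw, code x w hw ∈ G w ∧ x ∈ code x w hw := fun x w hw =>
    Exists.choose_spec (p := fun s => s ∈ G w ∧ x ∈ s) _
  -- a representative of each code
  let rep : ((w : ι) → w ∈ F → Set X) → Set X := fun t =>
    if h : ∃ x, code x = t then {y | ∀ i < n, T^[i] y ∈ u (T^[i] h.choose)} else Set.univ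
  let codes := (F.pi G).filter fun t => ∃ x, code x = t
  have hle : coverNumber (dynCover T U n) ≤ (codes.image rep).card := by
    refine coverNumber_le _ ?_ ?_
    · intro s hs
      obtain ⟨t, ht, rfl⟩ := Finset.mem_image.1 (Finset.mem_coe.1 hs)
      have hx := (Finset.mem_filter.1 ht).2
      refine mem_dynCover_iff.2 ⟨fun i => u (T^[i] hx.choose), fun i _ => huU _, ?_⟩
      simp only [rep, dif_pos hx]
    · refine Set.eq_univ_of_forall fun y => ?_
      have hy : ∃ x, code x = code y := ⟨y, rfl⟩
      refine ⟨rep (code y), ?_, ?_⟩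
      · refine Finset.mem_coe.2 (Finset.mem_image_of_mem _ (Finset.mem_filter.2 ⟨?_, hy⟩))
        exact Finset.mem_pi.2 fun w hw => (hcode y w hw).1
      · simp only [rep, dif_pos hy]
        intro i hi
        refine hu _ _ fun w hw => ?_
        obtain ⟨p, hp, hps⟩ := mem_dynCover_iff.1 ((hG w hw).1 (hcode y w hw).1)
        have h1 : y ∈ code y w hw := (hcode y w hw).2
        have h2 : hy.choose ∈ code y w hw := by
          have h3 := hcode hy.choose w hw
          rw [hy.choose_spec] at h3
          exact h3.2
        rw [hps] at h1 h2
        exact ⟨p i, hp i hi, h2 i hi, h1 i hi⟩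
  calc _ ≤ (codes.image rep).card := hle
    _ ≤ codes.card := Finset.card_image_le
    _ ≤ (F.pi G).card := Finset.card_filter_le _ _
    _ = ∏ w ∈ F, (G w).card := Finset.card_pi _ _
    _ = _ := Finset.prod_congr rfl fun w hw => (hG w hw).2.2

/-- Lebesgue number lemma for a separating family of functions on a compact Hausdorff space. -/
theorem exists_finset_lebesgue_number [TopologicalSpace X] [CompactSpace X] [T2Space X] {ι : Type*}
    {g : ι → X → ℝ} (hg : ∀ w, Continuous (g w)) (hsep : ∀ x y, (∀ w, g w x = g w y) → x = y)
    {U : Set (Set X)} (hU : IsFiniteOpenCover U) :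
    ∃ (F : Finset ι) (ε : ℝ), 0 < ε ∧
      ∀ x, ∃ u ∈ U, ∀ y, (∀ w ∈ F, |g w x - g w y| < ε) → y ∈ u := by
  classical
  let _ : UniformSpace X := uniformSpaceOfCompactR1
  obtain ⟨E, hE, hEU⟩ := lebesgue_number_lemma_sUnion isCompact_univ hU.isOpen
    (by rw [hU.covers])
  -- the complement of the entourage is compact and avoids the diagonal
  have hK : IsCompact (interior E)ᶜ := isOpen_interior.isClosed_compl.isCompact
  let O : ι × ℕ → Set (X × X) := fun z => {p | 1 / ((z.2 : ℝ) + 1) < |g z.1 p.1 - g z.1 p.2|}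
  have hO : ∀ z, IsOpen (O z) := fun z =>
    isOpen_lt continuous_const (((hg z.1).comp continuous_fst).sub
      ((hg z.1).comp continuous_snd)).abs
  have hcov : (interior E)ᶜ ⊆ ⋃ z, O z := by
    rintro ⟨x, y⟩ hxy
    have hne : x ≠ y := by
      rintro rfl
      exact hxy (refl_mem_uniformity (interior_mem_uniformity hE))
    obtain ⟨w, hw⟩ : ∃ w, g w x ≠ g w y := by
      by_contra! h
      exact hne (hsep x y h)
    obtain ⟨m, hm⟩ := exists_nat_one_div_lt (abs_pos.2 (sub_ne_zero.2 hw))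
    exact Set.mem_iUnion.2 ⟨(w, m), hm⟩
  obtain ⟨t, ht⟩ := hK.elim_finite_subcover O hO hcov
  refine ⟨t.image Prod.fst, 1 / ((t.sup Prod.snd : ℕ) + 1 : ℝ), by positivity, fun x => ?_⟩
  obtain ⟨u, hu, hxu⟩ := hEU x (Set.mem_univ x)
  refine ⟨u, hu, fun y hy => hxu ?_⟩
  by_contra hxy
  have hxy' : (x, y) ∈ (interior E)ᶜ := fun h => hxy (interior_subset (s := E) h)
  obtain ⟨z, hz, hzO⟩ := Set.mem_iUnion₂.1 (ht hxy')
  have h1 := hy z.1 (Finset.mem_image_of_mem _ hz)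
  have h2 : 1 / ((t.sup Prod.snd : ℕ) + 1 : ℝ) ≤ 1 / ((z.2 : ℝ) + 1) := by
    refine one_div_le_one_div_of_le (by positivity) ?_
    have h3 : z.2 ≤ t.sup Prod.snd := Finset.le_sup (f := Prod.snd) hz
    have h4 : (z.2 : ℝ) ≤ (t.sup Prod.snd : ℕ) := by exact_mod_cast h3
    linarith
  exact absurd hzO (not_lt.2 (h1.le.trans h2))

end Covers

/-! ### Independent iterates from positive entropy -/

section Slabs

variable {X : Type*}

/-- The cover of `X` by the preimages under `g` of the intervals `((p - 2) ε, (p + 2) ε)` for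
integers `|p| ≤ P`. -/
def slabCover (g : X → ℝ) (ε : ℝ) (P : ℕ) : Set (Set X) :=
  (fun p : ℤ => g ⁻¹' Set.Ioo ((p - 2) * ε) ((p + 2) * ε)) '' Set.Icc (-(P : ℤ)) P

theorem slabCover_finite (g : X → ℝ) (ε : ℝ) (P : ℕ) : (slabCover g ε P).Finite :=
  (Set.finite_Icc _ _).image _

theorem floor_div_mem_Icc {ε : ℝ} (hε : 0 < ε) {P : ℕ} {t : ℝ} (ht : |t| ≤ P * ε) :
    ⌊t / ε⌋ ∈ Set.Icc (-(P : ℤ)) P := by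
  obtain ⟨h1, h2⟩ := abs_le.1 ht
  constructor
  · rw [Int.le_floor, le_div_iff₀ hε]
    push_cast
    linarith
  · have h3 : t / ε ≤ P := by rwa [div_le_iff₀ hε]
    have h4 : (⌊t / ε⌋ : ℝ) ≤ P := (Int.floor_le _).trans h3
    exact_mod_cast h4

theorem mem_Ioo_of_floor_near {ε : ℝ} (hε : 0 < ε) {t : ℝ} {p : ℤ}
    (hp : |p - ⌊t / ε⌋| ≤ 1) : t ∈ Set.Ioo ((p - 2) * ε) ((p + 2) * ε) := by
  have h1 := Int.floor_le (t / ε)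
  have h2 := Int.lt_floor_add_one (t / ε)
  rw [le_div_iff₀ hε] at h1
  rw [div_lt_iff₀ hε] at h2
  obtain ⟨h3, h4⟩ := abs_le.1 hp
  have h3' : (⌊t / ε⌋ : ℝ) ≤ p + 1 := by exact_mod_cast (by omega : ⌊t / ε⌋ ≤ p + 1)
  have h4' : (p : ℝ) ≤ ⌊t / ε⌋ + 1 := by exact_mod_cast (by omega : p ≤ ⌊t / ε⌋ + 1)
  constructor <;> nlinarith

theorem slabCover_covers {g : X → ℝ} {ε : ℝ} (hε : 0 < ε) {P : ℕ} (hg : ∀ x, |g x| ≤ P * ε) :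
    ⋃₀ slabCover g ε P = Set.univ :=
  Set.eq_univ_of_forall fun x =>
    ⟨_, ⟨_, floor_div_mem_Icc hε (hg x), rfl⟩, mem_Ioo_of_floor_near hε (by simp)⟩

/-- Exponential growth along the slab cover of a single function `g` yields proportionally many
iterates at which the values of `g` can be prescribed to be low or high, independently, with a
gap `ε`. -/
theorem exists_independent_iterates (T : X → X) {g : X → ℝ} {ε : ℝ} (hε : 0 < ε) {P : ℕ}
    (hg : ∀ x, |g x| ≤ P * ε) {c : ℝ} (hc : 0 < c)
    (h : ∃ᶠ n : ℕ in atTop, Real.exp (c * n) ≤ coverNumber (dynCover T (slabCover g ε P) n)) :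
    ∃ d : ℝ, 0 < d ∧ ∃ᶠ n : ℕ in atTop, ∃ I ⊆ Finset.range n, d * n ≤ (I.card : ℝ) ∧
      ∀ b : ℕ → ℝ, ∃ x y, ε * ∑ i ∈ I, |b i| ≤ ∑ i ∈ I, b i * (g (T^[i] x) - g (T^[i] y)) := by
  classical
  let C := Set.Icc (-(P : ℤ)) P
  let sep : C → C → Prop := fun p q => 1 < |(p : ℤ) - q|
  have : Nonempty C := ⟨⟨0, by simp [C]⟩⟩
  obtain ⟨d, hd, n₀, hn₀⟩ := exists_isShattered_of_exp_le (sep := sep) (fun p => by simp [sep])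
    (fun p q h => by simpa [sep, abs_sub_comm] using h) hc
  refine ⟨d, hd, (h.and_eventually (eventually_ge_atTop n₀)).mono fun n hn => ?_⟩
  obtain ⟨hn, hn'⟩ := hn
  let cell : X → C := fun x => ⟨⌊g x / ε⌋, floor_div_mem_Icc hε (hg x)⟩
  let word : X → Fin n → C := fun x i => cell (T^[i] x)
  let S : Finset (Fin n → C) := Finset.univ.filter fun s => ∃ x, word x = s
  obtain ⟨ρ, hρ, hcard⟩ := hn₀ n hn' S (by
    intro G hG
    refine hn.trans ?_
    let box : (Fin n → C) → Set X := fun p => {x | ∀ i (hi : i < n), T^[i] x ∈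
      g ⁻¹' Set.Ioo (((p ⟨i, hi⟩ : ℤ) - 2) * ε) (((p ⟨i, hi⟩ : ℤ) + 2) * ε)}
    have h1 : coverNumber (dynCover T (slabCover g ε P) n) ≤ (G.image box).card := by
      refine coverNumber_le _ ?_ ?_
      · intro s hs
        obtain ⟨p, -, rfl⟩ := Finset.mem_image.1 (Finset.mem_coe.1 hs)
        refine mem_dynCover_iff.2 ⟨fun i => if hi : i < n then
          g ⁻¹' Set.Ioo (((p ⟨i, hi⟩ : ℤ) - 2) * ε) (((p ⟨i, hi⟩ : ℤ) + 2) * ε) else ∅,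
          fun i hi => ?_, ?_⟩
        · simp only [hi, dif_pos]
          exact ⟨_, (p ⟨i, hi⟩).2, rfl⟩
        · ext x
          simp only [box, Set.mem_ofPred_eq]
          refine forall₂_congr fun i hi => ?_
          simp only [hi, dif_pos]
      · refine Set.eq_univ_of_forall fun x => ?_
        obtain ⟨p, hp, hpx⟩ := hG (word x) (by simp [S])
        refine ⟨box p, Finset.mem_coe.2 (Finset.mem_image_of_mem _ hp), fun i hi => ?_⟩
        have := hpx ⟨i, hi⟩
        exact mem_Ioo_of_floor_near hε (by simpa [sep, word, cell] using this)
    exact_mod_cast h1.trans Finset.card_image_le)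
  let I₀ : Finset (Fin n) := Finset.univ.filter fun i => ρ i ≠ none
  refine ⟨I₀.map Fin.valEmbedding, ?_, ?_, fun b => ?_⟩
  · intro i hi
    obtain ⟨j, -, rfl⟩ := Finset.mem_map.1 hi
    simp
  · rw [Finset.card_map]
    rw [Set.ncard_eq_toFinset_card'] at hcard
    simpa [I₀] using hcard
  · -- choose the higher value exactly where the coefficient is nonnegative
    let high : Set (Fin n) := {i | ∀ pq, ρ i = some pq → ((0 ≤ b i) ↔ (pq.2 : ℤ) ≤ pq.1)}
    have hreal : ∀ J : Set (Fin n), ∃ x, ∀ i pq, ρ i = some pq →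
        (i ∈ J → cell (T^[i] x) = pq.1) ∧ (i ∉ J → cell (T^[i] x) = pq.2) := by
      intro J
      obtain ⟨s, hs, hs'⟩ := hρ.2 J
      obtain ⟨x, rfl⟩ := (Finset.mem_filter.1 hs).2
      exact ⟨x, hs'⟩
    have hgap : ∀ x y : X, (cell x : ℤ) + 1 < cell y → ε ≤ g y - g x := by
      intro x y hxy
      have h1 := Int.floor_le (g y / ε)
      have h2 := Int.lt_floor_add_one (g x / ε)
      rw [le_div_iff₀ hε] at h1
      rw [div_lt_iff₀ hε] at h2
      have h3 : (⌊g x / ε⌋ : ℝ) + 2 ≤ ⌊g y / ε⌋ := by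
        have : ⌊g x / ε⌋ + 1 < ⌊g y / ε⌋ := hxy
        exact_mod_cast (by omega : ⌊g x / ε⌋ + 2 ≤ ⌊g y / ε⌋)
      nlinarith
    obtain ⟨x, hx⟩ := hreal high
    obtain ⟨y, hy⟩ := hreal highᶜ
    refine ⟨x, y, ?_⟩
    rw [Finset.sum_map, Finset.sum_map, Finset.mul_sum]
    refine Finset.sum_le_sum fun i hi => ?_
    obtain ⟨pq, hpq⟩ := Option.ne_none_iff_exists'.1 (Finset.mem_filter.1 hi).2
    have hs : 1 < |(pq.1 : ℤ) - pq.2| := hρ.1 i pq hpq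
    have hmem : i ∈ high ↔ ((0 ≤ b i) ↔ (pq.2 : ℤ) ≤ pq.1) := by
      refine ⟨fun h => h pq hpq, fun h pq' h' => ?_⟩
      obtain rfl : pq = pq' := Option.some.inj (hpq.symm.trans h')
      exact h
    have key : (0 ≤ b i → ε ≤ g (T^[i] x) - g (T^[i] y)) ∧
        (b i < 0 → ε ≤ g (T^[i] y) - g (T^[i] x)) := by
      by_cases hi' : i ∈ high
      · have e1 := (hx i pq hpq).1 hi'
        have e2 := (hy i pq hpq).2 (by simpa using hi')
        have h5 := hmem.1 hi'
        constructor
        · intro hb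
          refine hgap _ _ ?_
          rw [e1, e2]
          have := h5.1 hb
          rw [abs_of_nonneg (by omega)] at hs
          omega
        · intro hb
          refine hgap _ _ ?_
          rw [e1, e2]
          have := mt h5.2 (not_le.2 hb)
          rw [abs_of_neg (by omega)] at hs
          omega
      · have e1 := (hx i pq hpq).2 hi'
        have e2 := (hy i pq hpq).1 hi'
        have h5 := mt hmem.2 hi'
        constructor
        · intro hb
          refine hgap _ _ ?_
          rw [e1, e2]
          have : ¬ (pq.2 : ℤ) ≤ pq.1 := fun h => h5 ⟨fun _ => h, fun _ => hb⟩
          rw [abs_of_neg (by omega)] at hs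
          omega
        · intro hb
          refine hgap _ _ ?_
          rw [e1, e2]
          have : (pq.2 : ℤ) ≤ pq.1 := by
            by_contra h
            exact h5 ⟨fun h' => absurd h' (not_le.2 hb), fun h' => absurd h' h⟩
          rw [abs_of_nonneg (by omega)] at hs
          omega
    simp only [Fin.valEmbedding_apply]
    rcases le_or_gt 0 (b i) with hb | hb
    · rw [abs_of_nonneg hb]
      nlinarith [key.1 hb]
    · rw [abs_of_neg hb]
      nlinarith [key.2 hb]

/-- Positive entropy of a compact system is detected by one function of any separating family, and
then produces independent iterates of that function. -/
theorem exists_independent_iterates_of_topEntropy_pos [TopologicalSpace X] [CompactSpace X]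
    [T2Space X] {T : X → X} (hT : 0 < topEntropy T) {ι : Type*} {g : ι → X → ℝ}
    (hg : ∀ w, Continuous (g w)) (hsep : ∀ x y, (∀ w, g w x = g w y) → x = y) :
    ∃ (w : ι) (ε d : ℝ), 0 < ε ∧ 0 < d ∧
      ∃ᶠ n : ℕ in atTop, ∃ I ⊆ Finset.range n, d * n ≤ (I.card : ℝ) ∧
        ∀ b : ℕ → ℝ, ∃ x y,
          ε * ∑ i ∈ I, |b i| ≤ ∑ i ∈ I, b i * (g w (T^[i] x) - g w (T^[i] y)) := by
  simp only [topEntropy, lt_iSup_iff] at hT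
  obtain ⟨U, hU, hpos⟩ := hT
  obtain ⟨c, hc0, hc⟩ := EReal.lt_iff_exists_real_btwn.1 hpos
  have hc0' : 0 < c := by exact_mod_cast hc0
  have hfreq : ∃ᶠ n : ℕ in atTop, c * n < Real.log (coverNumber (dynCover T U n)) := by
    have h1 := frequently_lt_of_lt_limsup (by isBoundedDefault) hc
    refine (h1.and_eventually (eventually_gt_atTop 0)).mono fun n hn => ?_
    have h2 : c < Real.log (coverNumber (dynCover T U n)) / n := by exact_mod_cast hn.1
    rwa [lt_div_iff₀ (by exact_mod_cast hn.2)] at h2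
  obtain ⟨F, ε, hε, hF⟩ := exists_finset_lebesgue_number hg hsep hU
  have hbdd : ∀ w, ∃ P : ℕ, ∀ x, |g w x| ≤ P * (ε / 4) := by
    intro w
    obtain ⟨B, hB⟩ := isCompact_univ.exists_bound_of_continuousOn (hg w).continuousOn
    obtain ⟨P, hP⟩ := exists_nat_ge (B / (ε / 4))
    rw [div_le_iff₀ (by positivity)] at hP
    exact ⟨P, fun x => (hB x (Set.mem_univ x)).trans hP⟩
  choose P hP using hbdd
  let V : ι → Set (Set X) := fun w => slabCover (g w) (ε / 4) (P w)
  have hVc : ∀ w, ⋃₀ V w = Set.univ := fun w => slabCover_covers (by positivity) (hP w)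
  have hprod := coverNumber_dynCover_le_prod T F V (fun w _ => slabCover_finite _ _ _)
    (fun w _ => hVc w) (U := U) (by
      intro x
      obtain ⟨u, hu, huy⟩ := hF x
      refine ⟨u, hu, fun y hy => huy y fun w hw => ?_⟩
      obtain ⟨v, ⟨p, -, rfl⟩, hx, hy⟩ := hy w hw
      simp only [Set.mem_preimage, Set.mem_Ioo] at hx hy
      rw [abs_lt]
      constructor <;> linarith)
  set c' : ℝ := c / (F.card + 1) with hc'
  have hc'0 : 0 < c' := by positivity
  have hw : ∃ w ∈ F, ∃ᶠ n : ℕ in atTop,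
      Real.exp (c' * n) ≤ coverNumber (dynCover T (V w) n) := by
    by_contra! hcon
    have h1 := (eventually_all_finset F).2 hcon
    obtain ⟨n, ⟨hn, h2⟩, hn0⟩ := ((hfreq.and_eventually h1).and_eventually
      (eventually_gt_atTop 0)).exists
    have hX : Nonempty X := by
      by_contra hX
      rw [not_nonempty_iff] at hX
      have h0 : coverNumber (dynCover T U n) = 0 :=
        Nat.le_zero.1 (coverNumber_le ∅ (by simp) (Subsingleton.elim _ _))
      rw [h0] at hn
      simp only [Nat.cast_zero, Real.log_zero] at hn
      have : 0 < c * n := by positivity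
      linarith
    have hpos : ∀ w, (0 : ℝ) < coverNumber (dynCover T (V w) n) := fun w => by
      exact_mod_cast coverNumber_pos (dynCover_finite T (slabCover_finite _ _ _) n)
        (dynCover_covers T (hVc w) n)
    have hposU : (0 : ℝ) < coverNumber (dynCover T U n) := by
      exact_mod_cast coverNumber_pos (dynCover_finite T hU.finite n) (dynCover_covers T hU.covers n)
    have h3 : Real.log (coverNumber (dynCover T U n)) ≤
        ∑ w ∈ F, Real.log (coverNumber (dynCover T (V w) n)) := by
      rw [← Real.log_prod fun w _ => (hpos w).ne']
      refine Real.log_le_log hposU ?_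
      exact_mod_cast hprod n
    have h4 : ∑ w ∈ F, Real.log (coverNumber (dynCover T (V w) n)) ≤ F.card * (c' * n) := by
      rw [← nsmul_eq_mul]
      refine Finset.sum_le_card_nsmul _ _ _ fun w hw => ?_
      rw [Real.log_le_iff_le_exp (hpos w)]
      exact (h2 w hw).le
    have h5 : F.card * (c' * n) ≤ c * n := by
      have : c = c' * (F.card + 1) := (div_mul_cancel₀ c (by positivity)).symm
      have h7 : c * n = F.card * (c' * n) + c' * n := by
        conv_lhs => rw [this]
        ring
      have h6 : 0 ≤ c' * n := mul_nonneg hc'0.le n.cast_nonneg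
      linarith
    linarith
  obtain ⟨w, -, hw⟩ := hw
  obtain ⟨d, hd, h⟩ := exists_independent_iterates T (by positivity : 0 < ε / 4) (hP w) hc'0 hw
  exact ⟨w, ε / 4, d, by positivity, hd, h⟩

end Slabs

/-! ### Infinite entropy from interpolation -/

section InfiniteEntropy

variable {X : Type*} [TopologicalSpace X]

/-- A continuous function on a compact space has finite open covers on whose members it varies by
less than `δ`. -/
theorem exists_isFiniteOpenCover_small_variation [CompactSpace X] {g : X → ℂ} (hg : Continuous g)
    {δ : ℝ} (hδ : 0 < δ) :
    ∃ U : Set (Set X), IsFiniteOpenCover U ∧ ∀ u ∈ U, ∀ x ∈ u, ∀ y ∈ u, ‖g x - g y‖ < δ := by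
  let O : X → Set X := fun x => g ⁻¹' Metric.ball (g x) (δ / 2)
  have hO : ∀ x, IsOpen (O x) := fun x => Metric.isOpen_ball.preimage hg
  obtain ⟨t, ht⟩ := isCompact_univ.elim_finite_subcover O hO fun x _ =>
    Set.mem_iUnion.2 ⟨x, Metric.mem_ball_self (by positivity)⟩
  refine ⟨O '' t, ⟨t.finite_toSet.image O, ?_, ?_⟩, ?_⟩
  · rintro _ ⟨x, -, rfl⟩
    exact hO x
  · rw [Set.sUnion_image]
    exact Set.eq_univ_of_univ_subset ht
  · rintro _ ⟨z, -, rfl⟩ x hx y hy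
    rw [← dist_eq_norm]
    have h1 : dist (g x) (g z) < δ / 2 := hx
    have h2 : dist (g y) (g z) < δ / 2 := hy
    linarith [dist_triangle_right (g x) (g y) (g z)]

/-- If every bounded complex function on a proportional set of times is a combination, with four
bounded coefficients, of orbits of `g`, then the entropy is infinite: on a `δ`-fine cover the
`m ^ |I|` functions with values in `{0, 1/m, …, (m - 1)/m}` must be distinguished by the four
itineraries and the four (discretised) coefficients. -/
theorem topEntropy_eq_top_of_interpolation [CompactSpace X] {T : X → X} {g : X → ℂ}
    (hg : Continuous g) {M d : ℝ} (hd : 0 < d)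
    (h : ∃ᶠ n : ℕ in atTop, ∃ I ⊆ Finset.range n, d * n ≤ (I.card : ℝ) ∧
      ∀ l : ℕ → ℂ, (∀ i, ‖l i‖ ≤ 1) → ∃ (x : Fin 4 → X) (b : Fin 4 → ℂ), (∀ j, ‖b j‖ ≤ M) ∧
        ∀ i ∈ I, l i = ∑ j, b j * g (T^[i] (x j))) :
    topEntropy T = ⊤ := by
  classical
  obtain ⟨B₀, hB₀⟩ := isCompact_univ.exists_bound_of_continuousOn hg.continuousOn
  set B : ℝ := |B₀| with hB
  have hgB : ∀ x, ‖g x‖ ≤ B := fun x => (hB₀ x (Set.mem_univ x)).trans (le_abs_self _)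
  have hB0 : 0 ≤ B := abs_nonneg _
  rw [EReal.eq_top_iff_forall_lt]
  intro r
  -- the number `m` of levels
  obtain ⟨m, hm⟩ : ∃ m : ℕ, Real.exp (4 * (|r| + 2) / d) ≤ m := exists_nat_ge _
  have hm0 : (0 : ℝ) < m := (Real.exp_pos _).trans_le hm
  have hm0' : 0 < m := by exact_mod_cast hm0
  have hlogm : |r| + 2 ≤ d / 4 * Real.log m := by
    have h1 := (Real.le_log_iff_exp_le hm0).2 hm
    rw [div_le_iff₀ hd] at h1
    linarith
  set δ : ℝ := 1 / (8 * m * (|M| + 2 * B + 1)) with hδ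
  have hδ0 : 0 < δ := by positivity
  obtain ⟨U, hU, hUδ⟩ := exists_isFiniteOpenCover_small_variation hg hδ0
  obtain ⟨Q, -, hQf, hQ⟩ := (isCompact_closedBall (0 : ℂ) M).finite_cover_balls hδ0
  let Qf : Finset ℂ := hQf.toFinset
  set K : ℝ := Real.log Qf.card with hK
  have hmain : ∃ᶠ n : ℕ in atTop, r + 1 ≤ Real.log (coverNumber (dynCover T U n)) / n := by
    have hev : ∀ᶠ n : ℕ in atTop, K ≤ n := by
      obtain ⟨N, hN⟩ := exists_nat_ge K
      filter_upwards [eventually_ge_atTop N] with n hn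
      exact hN.trans (by exact_mod_cast hn)
    refine ((h.and_eventually hev).and_eventually (eventually_gt_atTop 0)).mono ?_
    rintro n ⟨⟨⟨I, hI, hIcard, hint⟩, hKn⟩, hn0⟩
    have hn0' : (0 : ℝ) < n := by exact_mod_cast hn0
    obtain ⟨G, hG, hGc, hGn⟩ := coverNumber_spec (dynCover_finite T hU.finite n)
      (dynCover_covers T hU.covers n)
    let l : (I → Fin m) → ℕ → ℂ := fun f i => if hi : i ∈ I then ((f ⟨i, hi⟩ : ℕ) : ℂ) / m else 0
    have hl : ∀ f i, ‖l f i‖ ≤ 1 := by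
      intro f i
      simp only [l]
      split_ifs with hi
      · rw [norm_div, Complex.norm_natCast, Complex.norm_natCast, div_le_one hm0]
        exact_mod_cast (f ⟨i, hi⟩).2.le
      · simp
    choose x b hb hxb using fun f => hint (l f) (hl f)
    have hGx : ∀ f j, ∃ s ∈ G, x f j ∈ s := fun f j => by
      have := Set.mem_univ (x f j)
      rwa [← hGc] at this
    have hQb : ∀ f j, ∃ q ∈ Qf, ‖b f j - q‖ < δ := fun f j => by
      have h1 := hQ (mem_closedBall_zero_iff.2 (hb f j))
      obtain ⟨q, hq, hq'⟩ := Set.mem_iUnion₂.1 h1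
      exact ⟨q, hQf.mem_toFinset.2 hq, by rwa [← dist_eq_norm]⟩
    choose s hsG hxs using hGx
    choose q hqQ hqb using hQb
    let code : (I → Fin m) → Fin 4 → G × Qf := fun f j => (⟨s f j, hsG f j⟩, ⟨q f j, hqQ f j⟩)
    have hinj : Function.Injective code := by
      intro f f' hff
      have hterm : ∀ i ∈ I, ∀ j, ‖b f j * g (T^[i] (x f j)) - b f' j * g (T^[i] (x f' j))‖ ≤
          δ * (|M| + 2 * B) := by
        intro i hi j
        have h1 := congrFun hff j
        simp only [code, Prod.mk.injEq, Subtype.mk.injEq] at h1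
        obtain ⟨p, hp, hps⟩ := mem_dynCover_iff.1 (hG (hsG f j))
        have hin := Finset.mem_range.1 (hI hi)
        have e1 : T^[i] (x f j) ∈ p i := by
          have := hxs f j
          rw [hps] at this
          exact this i hin
        have e2 : T^[i] (x f' j) ∈ p i := by
          have := hxs f' j
          rw [← h1.1, hps] at this
          exact this i hin
        have e3 := (hUδ _ (hp i hin) _ e1 _ e2).le
        have e4 : ‖b f j - b f' j‖ ≤ 2 * δ := by
          have := hqb f' j
          rw [← h1.2] at this
          have h2 := norm_sub_le (b f j - q f j) (b f' j - q f j)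
          rw [sub_sub_sub_cancel_right] at h2
          linarith [hqb f j]
        have e5 : b f j * g (T^[i] (x f j)) - b f' j * g (T^[i] (x f' j)) =
            b f j * (g (T^[i] (x f j)) - g (T^[i] (x f' j))) +
              (b f j - b f' j) * g (T^[i] (x f' j)) := by ring
        rw [e5]
        refine (norm_add_le _ _).trans ?_
        rw [norm_mul, norm_mul]
        have e6 := mul_le_mul ((hb f j).trans (le_abs_self M)) e3 (norm_nonneg _) (abs_nonneg M)
        have e7 := mul_le_mul e4 (hgB (T^[i] (x f' j))) (norm_nonneg _) (by positivity)
        linarith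
      funext i
      have h1 : ‖l f i - l f' i‖ ≤ 4 * (δ * (|M| + 2 * B)) := by
        rw [hxb f i i.2, hxb f' i i.2, ← Finset.sum_sub_distrib]
        refine (norm_sum_le _ _).trans ?_
        refine (Finset.sum_le_sum fun j _ => hterm i i.2 j).trans ?_
        simp
      have h2 : 4 * (δ * (|M| + 2 * B)) < 1 / m := by
        rw [hδ, lt_div_iff₀ hm0]
        have h3 : (0 : ℝ) < |M| + 2 * B + 1 := by positivity
        have h4 : 4 * (1 / (8 * m * (|M| + 2 * B + 1)) * (|M| + 2 * B)) * m =
          (|M| + 2 * B) / (2 * (|M| + 2 * B + 1)) := by field_simp; norm_num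
        rw [h4, div_lt_one (by positivity)]
        have : 0 ≤ |M| + 2 * B := by positivity
        linarith
      by_contra hne
      have h3 : l f i - l f' i = (((f i : ℕ) : ℤ) - ((f' i : ℕ) : ℤ) : ℤ) / m := by
        simp [l]
        ring
      have h4 : (1 : ℝ) ≤ |((((f i : ℕ) : ℤ) - ((f' i : ℕ) : ℤ) : ℤ) : ℝ)| := by
        have : (((f i : ℕ) : ℤ) - ((f' i : ℕ) : ℤ) : ℤ) ≠ 0 := by
          intro h0
          exact hne (Fin.ext (by omega))
        exact_mod_cast Int.one_le_abs this
      rw [h3, norm_div, Complex.norm_natCast, Complex.norm_intCast] at h1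
      have h5 := div_le_div_of_nonneg_right h4 hm0.le
      linarith
    have hcount := Fintype.card_le_of_injective code hinj
    simp only [Fintype.card_fun, Fintype.card_prod, Fintype.card_coe, Fintype.card_fin] at hcount
    rw [hGn] at hcount
    set N := coverNumber (dynCover T U n) with hN
    have hpow : 0 < m ^ I.card := pow_pos hm0' _
    have hN0 : N ≠ 0 := by
      intro h0
      rw [h0] at hcount
      simp at hcount
      omega
    have hQ0 : Qf.card ≠ 0 := by
      intro h0
      rw [h0] at hcount
      simp at hcount
      omega
    have hlog : I.card * Real.log m ≤ 4 * (Real.log N + K) := by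
      rw [hK, ← Real.log_mul (by exact_mod_cast hN0) (by exact_mod_cast hQ0), ← Real.log_pow]
      have h1 : (4 : ℝ) * Real.log (N * Qf.card) = Real.log ((N * Qf.card) ^ 4) := by
        rw [Real.log_pow]; norm_num
      rw [h1]
      refine Real.log_le_log (by positivity) ?_
      exact_mod_cast hcount
    have hlm : 0 ≤ Real.log m := Real.log_natCast_nonneg _
    have h1 : (|r| + 2) * n ≤ Real.log N + K := by
      have h2 := mul_le_mul_of_nonneg_right hlogm hn0'.le
      have h3 := mul_le_mul_of_nonneg_right hIcard hlm
      linarith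
    rw [le_div_iff₀ hn0']
    have h4 := le_abs_self r
    nlinarith
  have h1 : ((r + 1 : ℝ) : EReal) ≤ coverEntropyOf T U :=
    le_limsup_of_frequently_le (hmain.mono fun n hn => EReal.coe_le_coe_iff.2 hn)
  refine lt_of_lt_of_le ?_ (h1.trans (le_iSup₂ (f := fun (U : Set (Set X))
    (_ : IsFiniteOpenCover U) => coverEntropyOf T U) U hU))
  exact_mod_cast lt_add_one r

end InfiniteEntropy

/-! ### Quasi-states -/

section NegativeCone

variable {A : Type*} [NonUnitalCStarAlgebra A] [PartialOrder A]

/-- The distance from `x` to the cone of negative elements. -/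
noncomputable def distNegCone (x : A) : ℝ := ⨅ y : {y : A // 0 ≤ y}, ‖x + y‖

theorem distNegCone_le (x : A) {y : A} (hy : 0 ≤ y) : distNegCone x ≤ ‖x + y‖ :=
  ciInf_le ⟨0, by rintro _ ⟨z, rfl⟩; exact norm_nonneg _⟩ (⟨y, hy⟩ : {y : A // 0 ≤ y})

instance : Nonempty {y : A // 0 ≤ y} := ⟨⟨0, le_rfl⟩⟩

theorem distNegCone_nonneg (x : A) : 0 ≤ distNegCone x :=
  le_ciInf fun _ => norm_nonneg _

theorem distNegCone_le_norm (x : A) : distNegCone x ≤ ‖x‖ := by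
  simpa using distNegCone_le x le_rfl

theorem exists_lt_of_distNegCone_lt {x : A} {r : ℝ} (h : distNegCone x < r) :
    ∃ y : A, 0 ≤ y ∧ ‖x + y‖ < r := by
  obtain ⟨y, hy⟩ := exists_lt_of_ciInf_lt h
  exact ⟨y, y.2, hy⟩

theorem distNegCone_neg {x : A} (hx : 0 ≤ x) : distNegCone (-x) = 0 :=
  le_antisymm (by simpa using distNegCone_le (-x) hx) (distNegCone_nonneg _)

variable [StarOrderedRing A]

theorem distNegCone_add_le (x y : A) : distNegCone (x + y) ≤ distNegCone x + distNegCone y := by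
  refine le_of_forall_pos_le_add fun ε hε => ?_
  obtain ⟨a, ha, ha'⟩ := exists_lt_of_distNegCone_lt (lt_add_of_pos_right (distNegCone x)
    (half_pos hε))
  obtain ⟨b, hb, hb'⟩ := exists_lt_of_distNegCone_lt (lt_add_of_pos_right (distNegCone y)
    (half_pos hε))
  have h1 := distNegCone_le (x + y) (add_nonneg ha hb)
  have h2 : x + y + (a + b) = (x + a) + (y + b) := by abel
  rw [h2] at h1
  linarith [norm_add_le (x + a) (y + b)]

theorem distNegCone_smul {c : ℝ} (hc : 0 < c) (x : A) :
    distNegCone (c • x) = c * distNegCone x := by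
  have key : ∀ {c : ℝ}, 0 < c → ∀ x : A, distNegCone (c • x) ≤ c * distNegCone x := by
    intro c hc x
    rw [← div_le_iff₀' hc]
    refine le_ciInf fun y => ?_
    rw [div_le_iff₀' hc]
    have h1 := distNegCone_le (c • x) (smul_nonneg hc.le y.2)
    rwa [← smul_add, norm_smul, Real.norm_of_nonneg hc.le] at h1
  refine le_antisymm (key hc x) ?_
  have h1 := key (inv_pos.2 hc) (c • x)
  rw [inv_smul_smul₀ hc.ne'] at h1
  rwa [← le_div_iff₀' hc, div_eq_inv_mul]

/-- The constant `3` is not optimal; it avoids positive and negative parts. -/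
theorem norm_le_three_mul_max_distNegCone (x : A) :
    ‖x‖ ≤ 3 * max (distNegCone x) (distNegCone (-x)) := by
  refine le_of_forall_pos_le_add fun ε hε => ?_
  set m := max (distNegCone x) (distNegCone (-x))
  obtain ⟨a, ha, ha'⟩ := exists_lt_of_distNegCone_lt
    (lt_of_le_of_lt (le_max_left _ _ : distNegCone x ≤ m) (lt_add_of_pos_right m (by positivity :
      (0 : ℝ) < ε / 3)))
  obtain ⟨b, hb, hb'⟩ := exists_lt_of_distNegCone_lt
    (lt_of_le_of_lt (le_max_right _ _ : distNegCone (-x) ≤ m)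
      (lt_add_of_pos_right m (by positivity : (0 : ℝ) < ε / 3)))
  -- `0 ≤ b ≤ (x + a) + (-x + b)`
  have h1 : ‖b‖ ≤ ‖(x + a) + (-x + b)‖ := by
    refine CStarAlgebra.norm_le_norm_of_nonneg_of_le hb ?_
    have : (x + a) + (-x + b) = a + b := by abel
    rw [this]
    exact le_add_of_nonneg_left ha
  have h2 := norm_add_le (x + a) (-x + b)
  have h3 : ‖x‖ ≤ ‖b‖ + ‖-x + b‖ := by
    have : x = b - (-x + b) := by abel
    calc ‖x‖ = ‖b - (-x + b)‖ := by rw [← this]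
      _ ≤ _ := norm_sub_le _ _
  linarith

end NegativeCone

section QuasiStates

variable {A : Type*} [NonUnitalCStarAlgebra A]

theorem zero_mem_quasiStateSpace : (0 : WeakDual ℂ A) ∈ quasiStateSpace A :=
  ⟨fun a => le_rfl, by simp⟩

theorem IsPositiveFunctional.im_eq_zero {σ : WeakDual ℂ A} (hσ : IsPositiveFunctional σ) {b : A}
    (hb : IsSelfAdjoint b) : (σ b).im = 0 := by
  let _ : PartialOrder A := CStarAlgebra.spectralOrder A
  have : StarOrderedRing A := CStarAlgebra.spectralOrderedRing A
  have key : ∀ c : A, 0 ≤ c → (σ c).im = 0 := by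
    intro c hc
    obtain ⟨d, rfl⟩ := CStarAlgebra.nonneg_iff_eq_star_mul_self.1 hc
    exact (Complex.le_def.1 (hσ d)).2.symm
  rw [← CFC.posPart_sub_negPart b hb, map_sub, Complex.sub_im, key _ (CFC.posPart_nonneg b),
    key _ (CFC.negPart_nonneg b), sub_zero]

/-- Existence of quasi-states by the Hahn–Banach theorem for the distance to the negative cone. -/
theorem exists_quasiState_re_eq [PartialOrder A] [StarOrderedRing A] {x : A}
    (hx : IsSelfAdjoint x) : ∃ σ ∈ quasiStateSpace A, (σ x).re = distNegCone x := by
  rcases eq_or_ne x 0 with rfl | hx0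
  · exact ⟨0, zero_mem_quasiStateSpace, by simpa using (distNegCone_neg (le_refl (0 : A))).symm⟩
  obtain ⟨φ, hφx, hφ⟩ := exists_extension_of_le_sublinear
    (LinearPMap.mkSpanSingleton x (distNegCone x) hx0) (distNegCone (A := A))
    (fun c hc y => distNegCone_smul hc y) distNegCone_add_le (by
      rintro ⟨y, hy⟩
      obtain ⟨c, rfl⟩ := Submodule.mem_span_singleton.1 hy
      have e : LinearPMap.mkSpanSingleton x (distNegCone x) hx0 ⟨c • x, hy⟩ =
          c * distNegCone x := LinearPMap.mkSpanSingleton'_apply _ _ _ _ _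
      rw [e]
      rcases lt_trichotomy c 0 with hc | rfl | hc
      · have h1 := distNegCone_smul (neg_pos.2 hc) x
        have h2 := distNegCone_add_le (c • x) ((-c) • x)
        rw [← add_smul, add_neg_cancel, zero_smul] at h2
        have h3 := distNegCone_nonneg (0 : A)
        change _ ≤ distNegCone (c • x)
        linarith
      · simpa using distNegCone_nonneg _
      · exact (distNegCone_smul hc x).ge)
  have hφx' : φ x = distNegCone x := by
    have h1 := hφx ⟨x, Submodule.mem_span_singleton_self x⟩
    exact h1.trans (LinearPMap.mkSpanSingleton_apply ℝ ℝ hx0 _)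
  have hφpos : ∀ y : A, 0 ≤ y → 0 ≤ φ y := by
    intro y hy
    have h1 := hφ (-y)
    rw [distNegCone_neg hy, map_neg] at h1
    linarith
  have hφle : ∀ y : A, |φ y| ≤ ‖y‖ := by
    intro y
    refine abs_le.2 ⟨?_, (hφ y).trans (distNegCone_le_norm y)⟩
    have h1 := (hφ (-y)).trans (distNegCone_le_norm (-y))
    rw [map_neg, norm_neg] at h1
    linarith
  -- a real functional that vanishes on skew-adjoint elements
  let f₀ : A →ₗ[ℝ] ℝ := φ ∘ₗ (selfAdjoint.submodule ℝ A).subtype ∘ₗ realPart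
  have hf₀ : ∀ y, f₀ y = φ (realPart y : A) := fun y => rfl
  let f : StrongDual ℝ A := f₀.mkContinuous 1 fun y => by
    rw [one_mul, Real.norm_eq_abs, hf₀]
    exact (hφle _).trans (realPart.norm_le y)
  have hf : ∀ y, f y = φ (realPart y : A) := fun y => rfl
  let σ : StrongDual ℂ A := f.extendRCLike
  have hσ : ∀ y, σ y = (f y : ℂ) - Complex.I * (f (Complex.I • y) : ℂ) := fun y => rfl
  have hσre : ∀ y : A, IsSelfAdjoint y → σ y = (φ y : ℂ) := by
    intro y hy
    have h1 : f (Complex.I • y) = 0 := by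
      rw [hf, realPart_I_smul]
      simp [hy.imaginaryPart]
    rw [hσ, h1, hf, hy.coe_realPart]
    simp
  refine ⟨StrongDual.toWeakDual σ, ⟨fun a => ?_, ?_⟩, ?_⟩
  · change 0 ≤ σ (star a * a)
    rw [hσre _ (IsSelfAdjoint.star_mul_self a)]
    exact_mod_cast hφpos _ (star_mul_self_nonneg a)
  · change ‖σ‖ ≤ 1
    rw [show σ = f.extendRCLike from rfl, StrongDual.norm_extendRCLike]
    exact LinearMap.mkContinuous_norm_le _ zero_le_one _
  · change (σ x).re = _
    rw [hσre x hx, hφx', Complex.ofReal_re]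

theorem exists_quasiStates_norm_le_sub {x : A} (hx : IsSelfAdjoint x) :
    ∃ σ ∈ quasiStateSpace A, ∃ τ ∈ quasiStateSpace A, ‖x‖ ≤ 3 * ((σ x).re - (τ x).re) := by
  let _ : PartialOrder A := CStarAlgebra.spectralOrder A
  have : StarOrderedRing A := CStarAlgebra.spectralOrderedRing A
  have h := norm_le_three_mul_max_distNegCone x
  rcases le_total (distNegCone (-x)) (distNegCone x) with h1 | h1
  · obtain ⟨σ, hσ, hσx⟩ := exists_quasiState_re_eq hx
    refine ⟨σ, hσ, 0, zero_mem_quasiStateSpace, ?_⟩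
    rw [max_eq_left h1, ← hσx] at h
    have h0 : (0 : WeakDual ℂ A) x = 0 := rfl
    simpa [h0] using h
  · obtain ⟨σ, hσ, hσx⟩ := exists_quasiState_re_eq hx.neg
    refine ⟨0, zero_mem_quasiStateSpace, σ, hσ, ?_⟩
    rw [max_eq_right h1, ← hσx] at h
    have h0 : (0 : WeakDual ℂ A) x = 0 := rfl
    simpa [h0] using h

theorem isClosed_setOf_isPositiveFunctional :
    IsClosed {σ : WeakDual ℂ A | IsPositiveFunctional σ} := by
  simp only [IsPositiveFunctional, Set.ofPred_forall]
  exact isClosed_iInter fun a => isClosed_le continuous_const (WeakDual.eval_continuous _)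

theorem isCompact_quasiStateSpace : IsCompact (quasiStateSpace A) := by
  have h1 : quasiStateSpace A = {σ : WeakDual ℂ A | IsPositiveFunctional σ} ∩
      WeakDual.toStrongDual ⁻¹' Metric.closedBall 0 1 := by
    ext σ
    simp [quasiStateSpace]
  rw [h1]
  exact (WeakDual.isCompact_closedBall (𝕜 := ℂ) (0 : StrongDual ℂ A) 1).inter_left
    isClosed_setOf_isPositiveFunctional

theorem convex_quasiStateSpace : Convex ℝ (quasiStateSpace A) := by
  intro σ hσ τ hτ s t hs ht hst
  refine ⟨fun a => ?_, ?_⟩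
  · change 0 ≤ (s : ℝ) • σ (star a * a) + (t : ℝ) • τ (star a * a)
    exact add_nonneg (smul_nonneg hs (hσ.1 a)) (smul_nonneg ht (hτ.1 a))
  · change ‖s • WeakDual.toStrongDual σ + t • WeakDual.toStrongDual τ‖ ≤ 1
    refine (norm_add_le _ _).trans ?_
    rw [norm_smul, norm_smul, Real.norm_of_nonneg hs, Real.norm_of_nonneg ht]
    have h1 := mul_le_mul_of_nonneg_left hσ.2 hs
    have h2 := mul_le_mul_of_nonneg_left hτ.2 ht
    linarith

/-- The values on `v` of the combination of four functionals with coefficients `M`, `iM`, `-M`,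
`-iM`. -/
noncomputable def fourfoldEval {ι : Type*} (M : ℝ) (v : ι → A) (x : Fin 4 → WeakDual ℂ A) (i : ι) :
    ℂ :=
  ∑ j : Fin 4, ((M : ℂ) * Complex.I ^ (j : ℕ)) * x j (v i)

theorem isLinearMap_fourfoldEval {ι : Type*} (M : ℝ) (v : ι → A) :
    IsLinearMap ℝ (fourfoldEval M v) := by
  constructor
  · intro x y
    funext i
    have h : ∀ j, (x + y) j (v i) = x j (v i) + y j (v i) := fun j => rfl
    simp only [fourfoldEval, Pi.add_apply (f := fourfoldEval M v x), ← Finset.sum_add_distrib,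
      ← mul_add, h]
  · intro r x
    funext i
    have h : ∀ j, (r • x) j (v i) = (r : ℂ) * x j (v i) := fun j => Complex.real_smul
    have h' : (r • fourfoldEval M v x) i = (r : ℂ) * fourfoldEval M v x i := Complex.real_smul
    rw [h']
    simp only [fourfoldEval, h, Finset.mul_sum]
    exact Finset.sum_congr rfl fun j _ => by ring

theorem continuous_fourfoldEval {ι : Type*} (M : ℝ) (v : ι → A) :
    Continuous (fourfoldEval M v) :=
  continuous_pi fun i => continuous_finsetSum _ fun j _ => continuous_const.mul
    ((WeakDual.eval_continuous (v i)).comp (continuous_apply j))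

/-- Four quasi-states, combined with coefficients `M`, `iM`, `-M`, `-iM`, norm an element up to the
factor `M / 3`: the first and third act on its real part, the others on its imaginary part. -/
theorem exists_re_sum_ge (M : ℝ) (hM : 0 ≤ M) (b : A) :
    ∃ x : Fin 4 → WeakDual ℂ A, (∀ j, x j ∈ quasiStateSpace A) ∧
      M / 3 * ‖b‖ ≤ (∑ j : Fin 4, ((M : ℂ) * Complex.I ^ (j : ℕ)) * x j b).re := by
  obtain ⟨σ₁, h₁, τ₁, h₁', hn₁⟩ := exists_quasiStates_norm_le_sub (realPart b).2
  obtain ⟨σ₂, h₂, τ₂, h₂', hn₂⟩ := exists_quasiStates_norm_le_sub (imaginaryPart b).2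
  have hre : ∀ σ ∈ quasiStateSpace A, (σ b).re = (σ (realPart b : A)).re ∧
      (σ b).im = (σ (imaginaryPart b : A)).re := by
    intro σ hσ
    have e1 := hσ.1.im_eq_zero (realPart b).2
    have e2 := hσ.1.im_eq_zero (imaginaryPart b).2
    have e3 : σ b = σ (realPart b : A) + Complex.I * σ (imaginaryPart b : A) := by
      conv_lhs => rw [← realPart_add_I_smul_imaginaryPart b]
      rw [map_add, map_smul, smul_eq_mul]
    rw [e3]
    simp [e1, e2]
  refine ⟨![σ₁, τ₂, τ₁, σ₂], ?_, ?_⟩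
  · intro j
    fin_cases j
    · exact h₁
    · exact h₂'
    · exact h₁'
    · exact h₂
  have h4 : (∑ j : Fin 4, ((M : ℂ) * Complex.I ^ (j : ℕ)) * ![σ₁, τ₂, τ₁, σ₂] j b).re =
      M * (((σ₁ (realPart b : A)).re - (τ₁ (realPart b : A)).re) +
        ((σ₂ (imaginaryPart b : A)).re - (τ₂ (imaginaryPart b : A)).re)) := by
    rw [Fin.sum_univ_four]
    rw [← (hre _ h₁).1, ← (hre _ h₁').1, ← (hre _ h₂).2, ← (hre _ h₂').2]
    have hI3 : Complex.I ^ 3 = -Complex.I := by rw [pow_succ, Complex.I_sq]; ring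
    simp [hI3]
    ring
  have h5 : ‖b‖ ≤ ‖(realPart b : A)‖ + ‖(imaginaryPart b : A)‖ := by
    conv_lhs => rw [← realPart_add_I_smul_imaginaryPart b]
    refine (norm_add_le _ _).trans ?_
    rw [norm_smul, Complex.norm_I, one_mul]
  rw [h4, div_mul_eq_mul_div, div_le_iff₀ (by norm_num), mul_assoc]
  exact mul_le_mul_of_nonneg_left (by linarith) hM

theorem exists_separating_coefficients {ι : Type*} [Fintype ι] {D : Set (ι → ℂ)} (hD : Convex ℝ D)
    (hD' : IsClosed D) {l : ι → ℂ} (hl : l ∉ D) :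
    ∃ (c : ι → ℂ) (u : ℝ), (∀ z ∈ D, (∑ i, c i * z i).re < u) ∧ u < (∑ i, c i * l i).re := by
  classical
  obtain ⟨f, u, hfu, hul⟩ := RCLike.geometric_hahn_banach_closed_point (𝕜 := ℂ) hD hD' hl
  have hf : ∀ z : ι → ℂ, ∑ i, f (Pi.single i 1) * z i = f z := by
    intro z
    conv_rhs => rw [← Finset.univ_sum_single z]
    rw [map_sum]
    refine Finset.sum_congr rfl fun i _ => ?_
    have : Pi.single i (z i) = z i • (Pi.single i (1 : ℂ) : ι → ℂ) := by
      rw [← Pi.single_smul, smul_eq_mul, mul_one]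
    rw [this, map_smul, smul_eq_mul, mul_comm]
  refine ⟨fun i => f (Pi.single i 1), u, fun z hz => ?_, ?_⟩
  · rw [hf]
    exact hfu z hz
  · rw [hf]
    exact hul

theorem convex_image_fourfoldEval {ι : Type*} (M : ℝ) (v : ι → A) :
    Convex ℝ (fourfoldEval M v '' {x | ∀ j, x j ∈ quasiStateSpace A}) := by
  refine Convex.is_linear_image ?_ (isLinearMap_fourfoldEval M v)
  intro x hx y hy s t hs ht hst j
  exact convex_quasiStateSpace (hx j) (hy j) hs ht hst

theorem isClosed_image_fourfoldEval {ι : Type*} (M : ℝ) (v : ι → A) :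
    IsClosed (fourfoldEval M v '' {x | ∀ j, x j ∈ quasiStateSpace A}) := by
  have h : IsCompact {x : Fin 4 → WeakDual ℂ A | ∀ j, x j ∈ quasiStateSpace A} :=
    isCompact_pi_infinite fun _ => isCompact_quasiStateSpace
  exact (h.image (continuous_fourfoldEval M v)).isClosed

/-- If `v` spans a uniformly isomorphic copy of finite-dimensional `ℓ₁`, then every bounded
prescription of values on `v` is attained by a combination of four quasi-states with coefficients
of fixed modulus. -/
theorem exists_quasiStates_interpolating {ι : Type*} [Fintype ι] (v : ι → A) {δ : ℝ} (hδ : 0 < δ)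
    (hv : ∀ c : ι → ℂ, δ * ∑ i, ‖c i‖ ≤ ‖∑ i, c i • v i‖) (l : ι → ℂ) (hl : ∀ i, ‖l i‖ ≤ 1) :
    ∃ x : Fin 4 → WeakDual ℂ A, (∀ j, x j ∈ quasiStateSpace A) ∧
      ∀ i, l i = fourfoldEval (3 / δ) v x i := by
  by_contra! hcon
  have hmem : l ∉ fourfoldEval (3 / δ) v '' {x | ∀ j, x j ∈ quasiStateSpace A} := by
    rintro ⟨x, hx, rfl⟩
    obtain ⟨i, hi⟩ := hcon x hx
    exact hi rfl
  -- separating coefficients give an element of the span of `v` of too small norm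
  obtain ⟨c, u, hcu, hul⟩ := exists_separating_coefficients
    (convex_image_fourfoldEval (3 / δ) v) (isClosed_image_fourfoldEval (3 / δ) v) hmem
  set b : A := ∑ i, c i • v i with hb
  have hcl : (∑ i, c i * l i).re ≤ ‖b‖ / δ := by
    rw [le_div_iff₀ hδ, mul_comm]
    refine le_trans (mul_le_mul_of_nonneg_left ?_ hδ.le) (hv c)
    refine (Complex.re_le_norm _).trans ((norm_sum_le _ _).trans (Finset.sum_le_sum fun i _ => ?_))
    rw [norm_mul]
    exact mul_le_of_le_one_right (norm_nonneg _) (hl i)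
  have hcx : ∀ x, ∑ i, c i * fourfoldEval (3 / δ) v x i =
      ∑ j : Fin 4, (((3 / δ : ℝ) : ℂ) * Complex.I ^ (j : ℕ)) * x j b := by
    intro x
    simp only [fourfoldEval, hb, map_sum, map_smul, smul_eq_mul, Finset.mul_sum]
    rw [Finset.sum_comm]
    refine Finset.sum_congr rfl fun j _ => Finset.sum_congr rfl fun i _ => ?_
    ring
  obtain ⟨x, hx, hxb⟩ := exists_re_sum_ge (3 / δ) (by positivity) b
  rw [← hcx] at hxb
  have h3 : (∑ i, c i * fourfoldEval (3 / δ) v x i).re < u := hcu _ ⟨x, hx, rfl⟩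
  have h5 : 3 / δ / 3 * ‖b‖ = ‖b‖ / δ := by field_simp
  linarith

end QuasiStates

/-! ### States of a unital algebra -/

section States

variable {A : Type*} [NonUnitalCStarAlgebra A]

theorem IsAlgebraUnit.star_eq {e : A} (he : IsAlgebraUnit e) : star e = e := by
  have h1 := (he (star e)).1
  have h2 := congrArg star h1
  rw [star_mul, star_star] at h2
  exact h1.symm.trans h2

/-- For a self-adjoint contraction `b` in a unital algebra, `e - b` is the square of `e - f(b)`
with `f(t) = 1 - √(1 - t)`. -/
theorem IsAlgebraUnit.exists_star_mul_self_eq_sub {e : A} (he : IsAlgebraUnit e) {b : A}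
    (hb : IsSelfAdjoint b) (hb1 : ‖b‖ ≤ 1) : ∃ z : A, star z * z = e - b := by
  let f : ℝ → ℝ := fun t => 1 - √(1 - t)
  have hc : ContinuousOn f (quasispectrum ℝ b) := by fun_prop
  have hf0 : f 0 = 0 := by simp [f]
  have hysa : IsSelfAdjoint (cfcₙ f b) := cfcₙ_predicate f b
  have hyy : cfcₙ f b * cfcₙ f b = cfcₙ f b + cfcₙ f b - b := by
    have hq : Set.EqOn (fun t => f t * f t) (fun t => (f t + f t) - t) (quasispectrum ℝ b) := by
      intro t ht
      have h1 : ‖t‖ ≤ 1 :=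
        (NonUnitalIsometricContinuousFunctionalCalculus.norm_quasispectrum_le b ht hb).trans hb1
      have h2 : t ≤ 1 := (le_abs_self t).trans h1
      have h3 := Real.mul_self_sqrt (sub_nonneg.2 h2)
      simp only [f]
      linarith
    have hadd : cfcₙ (fun t => f t + f t) b = cfcₙ f b + cfcₙ f b := cfcₙ_add f f b
    have hsub : cfcₙ (fun t => (f t + f t) - t) b =
        cfcₙ (fun t => f t + f t) b - cfcₙ (fun t : ℝ => t) b :=
      cfcₙ_sub (fun t => f t + f t) (fun t => t) b (hf := hc.add hc) (hf0 := by simp [hf0])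
    rw [← cfcₙ_mul f f b, cfcₙ_congr hq, hsub, hadd, cfcₙ_id' ℝ b hb]
  refine ⟨e - cfcₙ f b, ?_⟩
  rw [star_sub, he.star_eq, hysa.star_eq, sub_mul, mul_sub, mul_sub, (he e).1,
    (he (cfcₙ f b)).1, (he (cfcₙ f b)).2, hyy]
  abel

theorem IsPositiveFunctional.unit_nonneg {e : A} (he : IsAlgebraUnit e) {σ : WeakDual ℂ A}
    (hσ : IsPositiveFunctional σ) : 0 ≤ σ e := by
  have h := hσ e
  rwa [he.star_eq, (he e).1] at h

theorem IsPositiveFunctional.re_le_of_isSelfAdjoint {e : A} (he : IsAlgebraUnit e)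
    {σ : WeakDual ℂ A} (hσ : IsPositiveFunctional σ) {b : A} (hb : IsSelfAdjoint b) :
    (σ b).re ≤ (σ e).re * ‖b‖ := by
  rcases eq_or_ne b 0 with rfl | hb0
  · simp
  have hb0' : 0 < ‖b‖ := norm_pos_iff.2 hb0
  have hs : IsSelfAdjoint ((‖b‖⁻¹ : ℝ) • b) := (IsSelfAdjoint.all _).smul hb
  obtain ⟨z, hz⟩ := he.exists_star_mul_self_eq_sub hs (by
    rw [norm_smul, norm_inv, norm_norm, inv_mul_cancel₀ hb0'.ne'])
  have h1 := (Complex.le_def.1 (hσ z)).1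
  have h2 : σ ((‖b‖⁻¹ : ℝ) • b) = ((‖b‖⁻¹ : ℝ) : ℂ) * σ b := by
    rw [← Complex.coe_smul, map_smul, smul_eq_mul]
  rw [hz, map_sub, h2, Complex.sub_re, Complex.re_ofReal_mul, Complex.zero_re, sub_nonneg,
    inv_mul_le_iff₀ hb0', mul_comm] at h1
  exact h1

theorem IsPositiveFunctional.norm_le_unit {e : A} (he : IsAlgebraUnit e) {σ : WeakDual ℂ A}
    (hσ : IsPositiveFunctional σ) : ‖WeakDual.toStrongDual σ‖ ≤ (σ e).re := by
  have he0 : 0 ≤ (σ e).re := (Complex.le_def.1 (hσ.unit_nonneg he)).1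
  refine ContinuousLinearMap.opNorm_le_bound _ he0 fun a => ?_
  change ‖σ a‖ ≤ _
  -- rotate `a` so that the value becomes real
  obtain ⟨w, hw, hwa⟩ : ∃ w : ℂ, ‖w‖ = 1 ∧ w * σ a = ‖σ a‖ := by
    rcases eq_or_ne (σ a) 0 with h | h
    · exact ⟨1, by simp, by simp [h]⟩
    · have h' : (‖σ a‖ : ℂ) ≠ 0 := by exact_mod_cast norm_ne_zero_iff.2 h
      refine ⟨‖σ a‖ / σ a, ?_, by field_simp⟩
      rw [norm_div, Complex.norm_real, norm_norm, div_self (norm_ne_zero_iff.2 h)]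
  have h1 : σ (w • a) = ‖σ a‖ := by rw [map_smul, smul_eq_mul, hwa]
  have h2 : (σ (w • a)).re = (σ (realPart (w • a) : A)).re := by
    have e2 := hσ.im_eq_zero (imaginaryPart (w • a)).2
    conv_lhs => rw [← realPart_add_I_smul_imaginaryPart (w • a), map_add σ, map_smul σ, smul_eq_mul]
    simp [e2]
  calc ‖σ a‖ = (σ (w • a)).re := by rw [h1, Complex.ofReal_re]
    _ = (σ (realPart (w • a) : A)).re := h2
    _ ≤ (σ e).re * ‖(realPart (w • a) : A)‖ := hσ.re_le_of_isSelfAdjoint he (realPart (w • a)).2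
    _ ≤ (σ e).re * ‖w • a‖ := mul_le_mul_of_nonneg_left (realPart.norm_le (w • a)) he0
    _ = (σ e).re * ‖a‖ := by rw [norm_smul, hw, one_mul]

theorem stateSpace_subset_quasiStateSpace {e : A} (he : IsAlgebraUnit e) :
    stateSpace e ⊆ quasiStateSpace A := fun σ hσ =>
  ⟨hσ.1, (hσ.1.norm_le_unit he).trans (by rw [hσ.2, Complex.one_re])⟩

theorem isCompact_stateSpace {e : A} (he : IsAlgebraUnit e) : IsCompact (stateSpace e) := by
  refine isCompact_quasiStateSpace.of_isClosed_subset ?_ (stateSpace_subset_quasiStateSpace he)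
  exact isClosed_setOf_isPositiveFunctional.inter
    (isClosed_eq (WeakDual.eval_continuous e) continuous_const)

theorem IsPositiveFunctional.exists_state {e : A} (he : IsAlgebraUnit e) {σ : WeakDual ℂ A}
    (hσ : IsPositiveFunctional σ) (h0 : σ ≠ 0) : ∃ τ ∈ stateSpace e, ∀ a, σ a = σ e * τ a := by
  have hne : σ e ≠ 0 := by
    intro h
    have h1 := hσ.norm_le_unit he
    rw [h, Complex.zero_re] at h1
    have h2 := norm_le_zero_iff.1 h1
    exact h0 ((LinearEquiv.map_eq_zero_iff _).1 h2)
  refine ⟨(σ e)⁻¹ • σ, ⟨fun a => ?_, ?_⟩, fun a => ?_⟩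
  · exact mul_nonneg (inv_nonneg.2 (hσ.unit_nonneg he)) (hσ a)
  · exact inv_mul_cancel₀ hne
  · exact (mul_inv_cancel_left₀ hne (σ a)).symm

theorem nonempty_stateSpace {e : A} (he : IsAlgebraUnit e) {a : A} (ha : a ≠ 0) :
    (stateSpace e).Nonempty := by
  by_contra hemp
  have h0 : ∀ σ ∈ quasiStateSpace A, σ = 0 := by
    intro σ hσ
    by_contra h
    obtain ⟨τ, hτ, -⟩ := hσ.1.exists_state he h
    exact hemp ⟨τ, hτ⟩
  have h1 : ∀ x : A, IsSelfAdjoint x → x = 0 := by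
    intro x hx
    obtain ⟨σ, hσ, τ, hτ, h⟩ := exists_quasiStates_norm_le_sub hx
    rw [h0 σ hσ, h0 τ hτ, sub_self, mul_zero] at h
    exact norm_le_zero_iff.1 h
  apply ha
  rw [← realPart_add_I_smul_imaginaryPart a, h1 _ (realPart a).2, h1 _ (imaginaryPart a).2]
  simp

/-- If the algebra is nonzero, every quasi-state is a multiple of a state. -/
theorem exists_state_of_quasiState {e : A} (he : IsAlgebraUnit e) {a : A} (ha : a ≠ 0)
    {σ : WeakDual ℂ A} (hσ : σ ∈ quasiStateSpace A) :
    ∃ τ ∈ stateSpace e, ∃ t : ℂ, ‖t‖ ≤ 1 ∧ ∀ a, σ a = t * τ a := by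
  by_cases h : σ = 0
  · obtain ⟨τ, hτ⟩ := nonempty_stateSpace he ha
    exact ⟨τ, hτ, 0, by simp, fun a => by rw [h, zero_mul]; rfl⟩
  · obtain ⟨τ, hτ, hστ⟩ := hσ.1.exists_state he h
    refine ⟨τ, hτ, σ e, ?_, hστ⟩
    have hτ1 : ‖(WeakDual.toStrongDual σ) e‖ ≤ ‖WeakDual.toStrongDual σ‖ * ‖e‖ :=
      ContinuousLinearMap.le_opNorm _ _
    have he1 : ‖e‖ ≤ 1 := by
      have h1 : ‖e‖ * ‖e‖ = ‖e‖ := by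
        rw [← CStarRing.norm_star_mul_self, he.star_eq, (he e).1]
      nlinarith [norm_nonneg e]
    exact hτ1.trans (mul_le_one₀ hσ.2 (norm_nonneg e) he1)

end States

/-! ### Lower `ℓ₁` bounds -/

section EllOneSums

variable {X : Type*} [NormedAddCommGroup X] [NormedSpace ℂ X] {ι : Type*}

theorem hasSum_norm_ellOne (f : EllOne ι) : HasSum (fun i => ‖f i‖) ‖f‖ := by
  have h := lp.hasSum_norm (p := 1) (by simp) f
  simpa using h

theorem norm_ellOneBasis (i : ι) : ‖(ellOneBasis i : EllOne ι)‖ = 1 := by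
  classical
  simp only [ellOneBasis]
  rw [lp.norm_single one_pos, norm_one]

theorem norm_sum_ellOneBasis (s : Finset ι) (c : ι → ℂ) :
    ‖∑ i ∈ s, c i • (ellOneBasis i : EllOne ι)‖ = ∑ i ∈ s, ‖c i‖ := by
  classical
  have h := lp.norm_sum_single (p := 1) (E := fun _ : ι => ℂ) (by simp) c s
  simp only [ENNReal.toReal_one, Real.rpow_one] at h
  rw [← h]
  congr 1
  refine Finset.sum_congr rfl fun i _ => ?_
  have := lp.single_smul (𝕜 := ℂ) (E := fun _ : ι => ℂ) 1 i (c i) (1 : ℂ)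
  rw [smul_eq_mul, mul_one] at this
  rw [this]
  simp only [ellOneBasis]

/-- An isomorphism from `ℓ₁` sending the basis to `v` bounds linear combinations of `v` below. -/
theorem sum_norm_le_of_equiv {S : Submodule ℂ X} (Γ : EllOne ι ≃L[ℂ] S) {v : ι → X}
    (hΓ : ∀ i, (Γ (ellOneBasis i) : X) = v i) (s : Finset ι) (c : ι → ℂ) :
    ∑ i ∈ s, ‖c i‖ ≤ ‖(Γ.symm : S →L[ℂ] EllOne ι)‖ * ‖∑ i ∈ s, c i • v i‖ := by
  rw [← norm_sum_ellOneBasis]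
  set e : EllOne ι := ∑ i ∈ s, c i • ellOneBasis i with he
  have h1 : ‖∑ i ∈ s, c i • v i‖ = ‖Γ e‖ := by
    rw [he, map_sum, Submodule.coe_norm, Submodule.coe_sum]
    simp [hΓ]
  rw [h1]
  have h2 := (Γ.symm : S →L[ℂ] EllOne ι).le_opNorm (Γ e)
  simpa using h2

/-- A family that is bounded above and satisfies a lower `ℓ₁` bound spans a copy of `ℓ₁`. -/
theorem exists_equiv_of_lower_bound [CompleteSpace X] {v : ι → X} {B δ : ℝ} (hB : 0 ≤ B)
    (hδ : 0 < δ) (hvB : ∀ i, ‖v i‖ ≤ B)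
    (hv : ∀ (s : Finset ι) (c : ι → ℂ), δ * ∑ i ∈ s, ‖c i‖ ≤ ‖∑ i ∈ s, c i • v i‖)
    {S : Submodule ℂ X} (hS : S = (Submodule.span ℂ (Set.range v)).topologicalClosure) :
    ∃ Γ : EllOne ι ≃L[ℂ] S, (∀ i, (Γ (ellOneBasis i) : X) = v i) ∧
      ‖(Γ : EllOne ι →L[ℂ] S)‖ ≤ B ∧ ‖(Γ.symm : S →L[ℂ] EllOne ι)‖ ≤ δ⁻¹ := by
  classical
  have hbound : ∀ (f : EllOne ι) (i : ι), ‖f i • v i‖ ≤ B * ‖f i‖ := fun f i => by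
    rw [norm_smul, mul_comm]
    exact mul_le_mul_of_nonneg_right (hvB i) (norm_nonneg _)
  have hsumm : ∀ f : EllOne ι, Summable fun i => f i • v i := fun f =>
    Summable.of_norm_bounded ((hasSum_norm_ellOne f).summable.mul_left B) (hbound f)
  let Ψ₀ : EllOne ι →ₗ[ℂ] X :=
    { toFun := fun f => ∑' i, f i • v i
      map_add' := fun f g => by
        rw [← (hsumm f).tsum_add (hsumm g)]
        simp [add_smul]
      map_smul' := fun r f => by
        rw [RingHom.id_apply, ← (hsumm f).tsum_const_smul]
        simp [mul_smul] }
  have hΨ₀ : ∀ f, HasSum (fun i => f i • v i) (Ψ₀ f) := fun f => (hsumm f).hasSum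
  have hup : ∀ f, ‖Ψ₀ f‖ ≤ B * ‖f‖ := fun f =>
    tsum_of_norm_bounded ((hasSum_norm_ellOne f).mul_left B) (hbound f)
  have hlow : ∀ f, δ * ‖f‖ ≤ ‖Ψ₀ f‖ := fun f =>
    le_of_tendsto_of_tendsto' ((hasSum_norm_ellOne f).const_mul δ) (hΨ₀ f).norm fun s => hv s f
  let Ψ : EllOne ι →L[ℂ] X := Ψ₀.mkContinuous B hup
  have hΨ : ∀ f, Ψ f = Ψ₀ f := fun f => rfl
  have hbasis : ∀ i, Ψ (ellOneBasis i) = v i := by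
    intro i
    refine (hΨ₀ _).unique ?_
    have h1 : (ellOneBasis i : EllOne ι) i • v i = v i := by
      simp [ellOneBasis]
    rw [← h1]
    refine hasSum_single i fun j hj => ?_
    have h2 : (ellOneBasis i : EllOne ι) j = 0 := lp.single_apply_ne _ _ _ hj
    rw [h2, zero_smul]
  have hanti : AntilipschitzWith (Real.toNNReal δ⁻¹) Ψ :=
    ContinuousLinearMap.antilipschitz_of_bound Ψ fun f => by
      rw [Real.coe_toNNReal _ (inv_nonneg.2 hδ.le), le_inv_mul_iff₀ hδ]
      exact hlow f
  have hclosed : IsClosed (Set.range Ψ) := hanti.isClosed_range Ψ.uniformContinuous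
  have hrange : S = LinearMap.range (Ψ : EllOne ι →ₗ[ℂ] X) := by
    rw [hS]
    refine le_antisymm (Submodule.topologicalClosure_minimal _ ?_ ?_) ?_
    · rw [Submodule.span_le]
      rintro _ ⟨i, rfl⟩
      exact ⟨ellOneBasis i, hbasis i⟩
    · rw [LinearMap.coe_range]
      exact hclosed
    · rintro _ ⟨f, rfl⟩
      refine mem_closure_of_tendsto (hΨ₀ f) (Eventually.of_forall fun s => ?_)
      exact Submodule.sum_mem _ fun i _ => Submodule.smul_mem _ _ (Submodule.subset_span ⟨i, rfl⟩)
  subst hrange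
  let Γ := Ψ.equivRange hanti.injective hclosed
  have hΓ : ∀ f, (Γ f : X) = Ψ f := fun f => rfl
  refine ⟨Γ, fun i => (hΓ _).trans (hbasis i), ?_, ?_⟩
  · exact ContinuousLinearMap.opNorm_le_bound _ hB fun f => hup f
  · refine ContinuousLinearMap.opNorm_le_bound _ (inv_nonneg.2 hδ.le) fun y => ?_
    obtain ⟨f, rfl⟩ := Γ.surjective y
    rw [le_inv_mul_iff₀ hδ]
    have h1 := hlow f
    rw [ContinuousLinearEquiv.coe_coe, Γ.symm_apply_apply, Submodule.coe_norm, hΓ]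
    exact h1

end EllOneSums

section OrbitBounds

variable {X : Type*} [NormedAddCommGroup X] [NormedSpace ℂ X] (α : X ≃ₗᵢ[ℂ] X) (x : X)

/-- The iterates `α^i(x)`, `i ∈ s`, satisfy a lower `ℓ₁` bound with constant `δ`. -/
def EllOneBound (δ : ℝ) (s : Finset ℤ) : Prop :=
  ∀ c : ℤ → ℂ, δ * ∑ i ∈ s, ‖c i‖ ≤ ‖∑ i ∈ s, c i • (α ^ i) x‖

variable {α x}

theorem EllOneBound.mono {δ : ℝ} {s t : Finset ℤ} (h : EllOneBound α x δ t) (hst : s ⊆ t) :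
    EllOneBound α x δ s := by
  classical
  intro c
  have h1 := h fun i => if i ∈ s then c i else 0
  have e1 : ∑ i ∈ t, ‖if i ∈ s then c i else 0‖ = ∑ i ∈ s, ‖c i‖ := by
    rw [← Finset.sum_subset hst fun i _ hi => by simp [hi]]
    exact Finset.sum_congr rfl fun i hi => by simp [hi]
  have e2 : ∑ i ∈ t, (if i ∈ s then c i else 0) • (α ^ i) x = ∑ i ∈ s, c i • (α ^ i) x := by
    rw [← Finset.sum_subset hst fun i _ hi => by simp [hi]]
    exact Finset.sum_congr rfl fun i hi => by simp [hi]
  rwa [e1, e2] at h1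

theorem EllOneBound.translate {δ : ℝ} {s : Finset ℤ} (h : EllOneBound α x δ s) (m : ℤ) :
    EllOneBound α x δ (s.map (addRightEmbedding m)) := by
  intro c
  rw [Finset.sum_map, Finset.sum_map]
  refine (h fun i => c (i + m)).trans (le_of_eq ?_)
  have : ∑ i ∈ s, c (addRightEmbedding m i) • (α ^ (addRightEmbedding m i)) x =
      (α ^ m) (∑ i ∈ s, c (i + m) • (α ^ i) x) := by
    rw [map_sum]
    refine Finset.sum_congr rfl fun i _ => ?_
    rw [map_smul, addRightEmbedding_apply, add_comm i m, zpow_add]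
    rfl
  rw [this, LinearIsometryEquiv.norm_map]

theorem norm_zpow_apply (i : ℤ) : ‖(α ^ i) x‖ = ‖x‖ := LinearIsometryEquiv.norm_map _ _

theorem isEllOneIsomorphismSet_iff [CompleteSpace X] {I : Set ℤ} :
    IsEllOneIsomorphismSet α x I ↔
      I.Infinite ∧ ∃ δ : ℝ, 0 < δ ∧ ∀ s : Finset ℤ, (s : Set ℤ) ⊆ I → EllOneBound α x δ s := by
  classical
  refine and_congr_right fun hI => ⟨?_, ?_⟩
  · rintro ⟨Γ, hΓ⟩
    set N := ‖Γ.symm.toContinuousLinearMap‖ with hN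
    have hN0 : 0 ≤ N := ContinuousLinearMap.opNorm_nonneg _
    refine ⟨(N + 1)⁻¹, by positivity, fun s hs c => ?_⟩
    have h1 := sum_norm_le_of_equiv Γ (v := fun i : I => (α ^ (i : ℤ)) x) hΓ
      (s.subtype (· ∈ I)) fun i => c i
    rw [Finset.sum_subtype_of_mem (fun i => ‖c i‖) hs,
      Finset.sum_subtype_of_mem (fun i => c i • (α ^ i) x) hs] at h1
    rw [inv_mul_le_iff₀ (by positivity)]
    refine h1.trans (mul_le_mul_of_nonneg_right ?_ (norm_nonneg _))
    linarith
  · rintro ⟨δ, hδ, h⟩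
    obtain ⟨Γ, hΓ, -⟩ := exists_equiv_of_lower_bound (v := fun i : I => (α ^ (i : ℤ)) x)
      (norm_nonneg x) hδ (fun i => (norm_zpow_apply _).le) (fun s c => by
        have h1 := h (s.map (Function.Embedding.subtype _)) (by
          intro i hi
          simp only [Finset.coe_map, Set.mem_image] at hi
          obtain ⟨j, -, rfl⟩ := hi
          exact j.2) (fun i => if hi : i ∈ I then c ⟨i, hi⟩ else 0)
        simpa [Finset.sum_map] using h1)
      (S := (Submodule.span ℂ ((fun i : ℤ => (α ^ i) x) '' I)).topologicalClosure)
      (by rw [Set.image_eq_range])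
    exact ⟨Γ, hΓ⟩

theorem HasProportionalEllOneIterates.ne_zero (h : HasProportionalEllOneIterates α x) : x ≠ 0 := by
  rintro rfl
  obtain ⟨K, d, n, I, hK, hd, hn, h⟩ := h
  obtain ⟨k, hk⟩ := (hn.eventually_gt_atTop 0).exists
  obtain ⟨-, hcard, Γ, hΓ, -⟩ := h k
  have hpos : (0 : ℝ) < (I k).card := by
    have : (0 : ℝ) < n k := by exact_mod_cast hk
    exact lt_of_lt_of_le (by positivity) hcard
  obtain ⟨i, hi⟩ := Finset.card_pos.1 (by exact_mod_cast hpos)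
  have h1 : Γ (ellOneBasis ⟨i, hi⟩) = 0 := Subtype.ext (by rw [hΓ]; simp)
  have h2 := norm_ellOneBasis (⟨i, hi⟩ : I k)
  rw [(map_eq_zero_iff Γ Γ.injective).1 h1, norm_zero] at h2
  exact zero_ne_one h2

theorem hasProportionalEllOneIterates_iff [CompleteSpace X] :
    HasProportionalEllOneIterates α x ↔
      ∃ δ d : ℝ, 0 < δ ∧ 0 < d ∧ ∃ᶠ n : ℕ in atTop, ∃ I ⊆ Finset.range n,
        d * n ≤ (I.card : ℝ) ∧ EllOneBound α x δ (I.map Nat.castEmbedding) := by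
  classical
  constructor
  · rintro ⟨K, d, n, I, hK, hd, hn, h⟩
    have hx : x ≠ 0 := HasProportionalEllOneIterates.ne_zero ⟨K, d, n, I, hK, hd, hn, h⟩
    have hx' : 0 < ‖x‖ := norm_pos_iff.2 hx
    refine ⟨‖x‖ / K, d, by positivity, hd, hn.frequently (Frequently.of_forall fun k => ?_)⟩
    obtain ⟨hI, hcard, Γ, hΓ, hΓK⟩ := h k
    refine ⟨I k, hI, hcard, fun c => ?_⟩
    have h1 := sum_norm_le_of_equiv Γ (v := fun i : I k => (α ^ (i : ℕ)) x) hΓ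
      Finset.univ fun i => c (i : ℕ)
    rw [Finset.sum_coe_sort (I k) (fun i : ℕ => ‖c i‖),
      Finset.sum_coe_sort (I k) (fun i : ℕ => c i • (α ^ i) x)] at h1
    rw [Finset.sum_map, Finset.sum_map]
    simp only [Nat.castEmbedding_apply, zpow_natCast]
    rcases (I k).eq_empty_or_nonempty with hemp | ⟨i, hi⟩
    · simp [hemp]
    have hΓx : ‖x‖ ≤ ‖Γ.toContinuousLinearMap‖ := by
      have h2 := Γ.toContinuousLinearMap.le_opNorm (ellOneBasis ⟨i, hi⟩)
      rw [norm_ellOneBasis, mul_one] at h2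
      refine le_trans (le_of_eq ?_) h2
      rw [ContinuousLinearEquiv.coe_coe, Submodule.coe_norm, hΓ]
      exact (LinearIsometryEquiv.norm_map _ _).symm
    rw [div_mul_eq_mul_div, div_le_iff₀' hK]
    calc ‖x‖ * ∑ i ∈ I k, ‖c i‖
        ≤ ‖Γ.toContinuousLinearMap‖ * (‖Γ.symm.toContinuousLinearMap‖ *
            ‖∑ i ∈ I k, c i • (α ^ i) x‖) :=
          mul_le_mul hΓx h1 (Finset.sum_nonneg fun _ _ => norm_nonneg _)
            (ContinuousLinearMap.opNorm_nonneg _)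
      _ ≤ K * ‖∑ i ∈ I k, c i • (α ^ i) x‖ := by
          rw [← mul_assoc]
          exact mul_le_mul_of_nonneg_right hΓK (norm_nonneg _)
  · rintro ⟨δ, d, hδ, hd, h⟩
    obtain ⟨n, hn, h⟩ := exists_seq_forall_of_frequently h
    choose I hI hcard hbd using h
    refine ⟨‖x‖ * δ⁻¹ + 1, d, n, I, by positivity, hd, hn, fun k => ⟨hI k, hcard k, ?_⟩⟩
    have hfin : FiniteDimensional ℂ
        (Submodule.span ℂ ((fun i : ℕ => (α ^ i) x) '' (I k : Set ℕ))) :=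
      FiniteDimensional.span_of_finite ℂ ((I k).finite_toSet.image _)
    obtain ⟨Γ, hΓ, h1, h2⟩ := exists_equiv_of_lower_bound
      (v := fun i : I k => (α ^ (i : ℕ)) x) (norm_nonneg x) hδ
      (fun i => (LinearIsometryEquiv.norm_map _ _).le) (fun s c => by
        have h1 := (hbd k).mono (s := (s.map (Function.Embedding.subtype _)).map Nat.castEmbedding)
          (Finset.map_subset_map.2 (by
            intro i hi
            obtain ⟨j, -, rfl⟩ := Finset.mem_map.1 hi
            exact j.2)) (fun i => if hi : i.toNat ∈ I k then c ⟨i.toNat, hi⟩ else 0)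
        simpa [Finset.sum_map] using h1)
      (S := Submodule.span ℂ ((fun i : ℕ => (α ^ i) x) '' (I k : Set ℕ)))
      (by
        have hr : Set.range (fun i : I k => (α ^ (i : ℕ)) x) =
            (fun i : ℕ => (α ^ i) x) '' (I k : Set ℕ) := by
          rw [Set.image_eq_range]
          rfl
        rw [hr]
        exact (Submodule.closed_of_finiteDimensional _).submodule_topologicalClosure_eq.symm)
    refine ⟨Γ, hΓ, ?_⟩
    have h3 := mul_le_mul h1 h2 (ContinuousLinearMap.opNorm_nonneg _) (norm_nonneg x)
    exact h3.trans (by linarith)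

end OrbitBounds

/-! ### Sets of positive density in hereditary translation-invariant families -/

section Density

variable {P : Finset ℤ → Prop}

open Classical in
/-- The largest cardinality of a member of the family `P` contained in `{0, …, n - 1}`. -/
noncomputable def maxCard (P : Finset ℤ → Prop) (n : ℕ) : ℕ :=
  ((Finset.Ico (0 : ℤ) n).powerset.filter P).sup Finset.card

theorem card_le_maxCard (htrans : ∀ s m, P s → P (s.map (addRightEmbedding m))) {s : Finset ℤ}
    (hs : P s) {a : ℤ} {n : ℕ} (hsub : s ⊆ Finset.Ico a (a + n)) : s.card ≤ maxCard P n := by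
  classical
  have h := Finset.le_sup (f := Finset.card)
    (s := (Finset.Ico (0 : ℤ) n).powerset.filter P) (b := s.map (addRightEmbedding (-a))) (by
      refine Finset.mem_filter.2 ⟨Finset.mem_powerset.2 fun i hi => ?_, htrans _ _ hs⟩
      obtain ⟨j, hj, rfl⟩ := Finset.mem_map.1 hi
      have := Finset.mem_Ico.1 (hsub hj)
      rw [addRightEmbedding_apply, Finset.mem_Ico]
      omega)
  rwa [Finset.card_map] at h

theorem exists_card_eq_maxCard (h0 : P ∅) (n : ℕ) :
    ∃ s ⊆ Finset.Ico (0 : ℤ) n, P s ∧ s.card = maxCard P n := by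
  classical
  obtain ⟨s, hs, hs'⟩ := Finset.exists_mem_eq_sup
    ((Finset.Ico (0 : ℤ) n).powerset.filter P) ⟨∅, by simp [h0]⟩ Finset.card
  obtain ⟨h1, h2⟩ := Finset.mem_filter.1 hs
  exact ⟨s, Finset.mem_powerset.1 h1, h2, hs'.symm⟩

theorem subadditive_maxCard (hmono : ∀ s t, s ⊆ t → P t → P s)
    (htrans : ∀ s m, P s → P (s.map (addRightEmbedding m))) (h0 : P ∅) :
    Subadditive fun n => (maxCard P n : ℝ) := by
  intro m n
  obtain ⟨s, hs, hPs, hcard⟩ := exists_card_eq_maxCard h0 (m + n)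
  have h1 : (s.filter (· < (m : ℤ))).card ≤ maxCard P m :=
    card_le_maxCard htrans (hmono _ _ (Finset.filter_subset _ _) hPs) (a := 0) fun i hi => by
      obtain ⟨h1, h2⟩ := Finset.mem_filter.1 hi
      have := Finset.mem_Ico.1 (hs h1)
      rw [Finset.mem_Ico]
      omega
  have h2 : (s.filter (¬ · < (m : ℤ))).card ≤ maxCard P n :=
    card_le_maxCard htrans (hmono _ _ (Finset.filter_subset _ _) hPs) (a := m) fun i hi => by
      obtain ⟨h1, h2⟩ := Finset.mem_filter.1 hi
      have := Finset.mem_Ico.1 (hs h1)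
      rw [Finset.mem_Ico]
      push_cast at this
      omega
  have h3 := Finset.card_filter_add_card_filter_not (s := s) (· < (m : ℤ))
  have h4 : maxCard P (m + n) ≤ maxCard P m + maxCard P n := by omega
  dsimp only
  exact_mod_cast h4

/-- Starting a nearly maximal member of the family at a time at which its count is
furthest behind the linear rate makes all its initial averages nearly maximal. -/
theorem exists_uniformly_dense_start
    (htrans : ∀ s m, P s → P (s.map (addRightEmbedding m))) (h0 : P ∅) {D : ℝ} (hD0 : 0 ≤ D)
    (hD : ∀ n, D * n ≤ maxCard P n) {ε : ℝ} (hε : 0 < ε) (N : ℕ) :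
    ∃ s, P s ∧ ∀ n ≤ N, (D - ε) * n ≤ (s ∩ Finset.Ico (0 : ℤ) n).card := by
  obtain ⟨M, hM⟩ := exists_nat_ge (N * (1 + ε) / ε)
  rw [div_le_iff₀ hε] at hM
  obtain ⟨s, hs, hPs, hcard⟩ := exists_card_eq_maxCard h0 M
  let g : ℕ → ℝ := fun m => (s ∩ Finset.Ico (0 : ℤ) m).card - (D - ε) * m
  obtain ⟨m, hm, hmin⟩ := Finset.exists_min_image (Finset.range (M + 1)) g ⟨0, by simp⟩
  have hmM : m ≤ M := Nat.lt_succ_iff.1 (Finset.mem_range.1 hm)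
  -- additivity of the counts on consecutive windows
  have hsplit : ∀ k : ℕ, (s ∩ Finset.Ico (0 : ℤ) (m + k : ℕ)).card =
      (s ∩ Finset.Ico (0 : ℤ) m).card + (s ∩ Finset.Ico (m : ℤ) (m + k : ℕ)).card := by
    intro k
    rw [← Finset.card_union_of_disjoint, ← Finset.inter_union_distrib_left,
      Finset.Ico_union_Ico_eq_Ico (by omega) (by omega)]
    exact (Finset.Ico_disjoint_Ico_consecutive _ _ _).mono Finset.inter_subset_right
      Finset.inter_subset_right
  have hroom : N ≤ M - m := by
    have h1 := hmin 0 (by simp)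
    simp only [g, Nat.cast_zero, Finset.Ico_self, Finset.inter_empty, Finset.card_empty, mul_zero,
      sub_zero, sub_nonpos] at h1
    have h2 := hsplit (M - m)
    rw [Nat.add_sub_cancel' hmM, Finset.inter_eq_left.2 hs, hcard] at h2
    have h3 : (s ∩ Finset.Ico (m : ℤ) M).card ≤ M - m := by
      refine (Finset.card_le_card Finset.inter_subset_right).trans ?_
      simp
    have h4 := hD M
    have h5 : (maxCard P M : ℝ) ≤ (s ∩ Finset.Ico (0 : ℤ) m).card + ((M : ℝ) - m) := by
      rw [← Nat.cast_sub hmM]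
      exact_mod_cast h2.le.trans (Nat.add_le_add_left h3 _)
    have hmM' : (m : ℝ) ≤ M := by exact_mod_cast hmM
    have h6 : ε * M ≤ (1 + ε) * ((M : ℝ) - m) := by nlinarith
    have h7 : (N : ℝ) ≤ (M : ℝ) - m := by
      have : (0 : ℝ) < 1 + ε := by linarith
      nlinarith
    have h8 : (N + m : ℝ) ≤ M := by linarith
    have h9 : N + m ≤ M := by exact_mod_cast h8
    omega
  refine ⟨s.map (addRightEmbedding (-(m : ℤ))), htrans _ _ hPs, fun n hn => ?_⟩
  have h1 := hmin (m + n) (by rw [Finset.mem_range]; omega)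
  have h2 : (s.map (addRightEmbedding (-(m : ℤ))) ∩ Finset.Ico (0 : ℤ) n).card =
      (s ∩ Finset.Ico (m : ℤ) (m + n : ℕ)).card := by
    have : s.map (addRightEmbedding (-(m : ℤ))) ∩ Finset.Ico (0 : ℤ) n =
        (s ∩ Finset.Ico (m : ℤ) (m + n : ℕ)).map (addRightEmbedding (-(m : ℤ))) := by
      rw [Finset.map_inter, Finset.map_add_right_Ico]
      simp
    rw [this, Finset.card_map]
  simp only [g] at h1
  rw [h2]
  rw [hsplit n] at h1
  push_cast at h1 ⊢
  linarith

/-- A hereditary translation-invariant family of finite sets of integers that has members of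
positive upper density in arbitrarily long windows admits an infinite set of positive density all
of whose finite subsets belong to the family. -/
theorem exists_hasDensity_of_frequently (hmono : ∀ s t, s ⊆ t → P t → P s)
    (htrans : ∀ s m, P s → P (s.map (addRightEmbedding m))) {d : ℝ} (hd : 0 < d)
    (h : ∃ᶠ n : ℕ in atTop, ∃ s ⊆ Finset.Ico (0 : ℤ) n, P s ∧ d * n ≤ s.card) :
    ∃ (J : Set ℤ) (D : ℝ), 0 < D ∧ HasDensity J D ∧ J.Infinite ∧
      ∀ t : Finset ℤ, (t : Set ℤ) ⊆ J → P t := by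
  classical
  have h0 : P ∅ := by
    obtain ⟨n, s, -, hs, -⟩ := h.exists
    exact hmono _ _ (Finset.empty_subset s) hs
  have hsub := subadditive_maxCard hmono htrans h0
  have hbdd : BddBelow (Set.range fun n : ℕ => (maxCard P n : ℝ) / n) :=
    ⟨0, by rintro _ ⟨n, rfl⟩; positivity⟩
  set D := hsub.lim with hDdef
  have hlim : Tendsto (fun n : ℕ => (maxCard P n : ℝ) / n) atTop (𝓝 D) := hsub.tendsto_lim hbdd
  have hDd : d ≤ D := by
    by_contra! hlt
    have h1 := hlim.eventually (gt_mem_nhds hlt)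
    obtain ⟨n, ⟨⟨s, hs, hPs, hcard⟩, hn⟩, hn0⟩ := ((h.and_eventually h1).and_eventually
      (eventually_gt_atTop 0)).exists
    have hn0' : (0 : ℝ) < n := by exact_mod_cast hn0
    rw [div_lt_iff₀ hn0'] at hn
    have h2 : (s.card : ℝ) ≤ maxCard P n := by
      exact_mod_cast card_le_maxCard htrans hPs (a := 0) (by simpa using hs)
    linarith
  have hD0 : 0 < D := hd.trans_le hDd
  have hDn : ∀ n : ℕ, D * n ≤ maxCard P n := by
    intro n
    rcases Nat.eq_zero_or_pos n with rfl | hn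
    · simp
    · have := hsub.lim_le_div hbdd hn.ne'
      rwa [le_div_iff₀ (by exact_mod_cast hn)] at this
  choose s hPs hs using fun N : ℕ => exists_uniformly_dense_start htrans h0 hD0.le hDn
    (ε := 1 / ((N : ℝ) + 1)) (by positivity) N
  -- the limit of the sets `s N` along an ultrafilter
  let J : Set ℤ := {i | 0 ≤ i ∧ ∀ᶠ N in (hyperfilter ℕ : Filter ℕ), i ∈ s N}
  have hJP : ∀ t : Finset ℤ, (t : Set ℤ) ⊆ J → P t := by
    intro t ht
    have h1 : ∀ᶠ N in (hyperfilter ℕ : Filter ℕ), ∀ i ∈ t, i ∈ s N :=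
      (eventually_all_finset t).2 fun i hi => (ht hi).2
    obtain ⟨N, hN⟩ := h1.exists
    exact hmono _ _ hN (hPs N)
  let w : ℕ → Finset ℤ := fun n => (Finset.Ico (0 : ℤ) n).filter (· ∈ J)
  have hup : ∀ n, ((w n).card : ℝ) ≤ maxCard P n := by
    intro n
    have h1 : P (w n) := hJP _ fun i hi => (Finset.mem_filter.1 hi).2
    exact_mod_cast card_le_maxCard htrans h1 (a := 0)
      (by simp [w, Finset.filter_subset])
  have hlow : ∀ n, D * n ≤ (w n).card := by
    intro n
    refine le_of_forall_pos_le_add fun ε hε => ?_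
    have h1 : ∀ᶠ N in (hyperfilter ℕ : Filter ℕ), ∀ i ∈ Finset.Ico (0 : ℤ) n,
        (i ∈ s N → i ∈ J) := by
      refine (eventually_all_finset _).2 fun i hi => ?_
      by_cases hiJ : i ∈ J
      · exact Eventually.of_forall fun _ _ => hiJ
      · have h2 : ¬ ∀ᶠ N in (hyperfilter ℕ : Filter ℕ), i ∈ s N :=
          fun h => hiJ ⟨(Finset.mem_Ico.1 hi).1, h⟩
        exact (Ultrafilter.eventually_not.2 h2).mono fun N hN hN' => absurd hN' hN
    have h2 : ∀ᶠ N in (hyperfilter ℕ : Filter ℕ), n ≤ N :=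
      Nat.hyperfilter_le_atTop (eventually_ge_atTop n)
    have h3 : ∀ᶠ N : ℕ in (hyperfilter ℕ : Filter ℕ), 1 / ((N : ℝ) + 1) * n < ε := by
      refine Nat.hyperfilter_le_atTop ?_
      have h4 := (tendsto_one_div_add_atTop_nhds_zero_nat (𝕜 := ℝ)).mul_const (n : ℝ)
      rw [zero_mul] at h4
      exact h4.eventually (gt_mem_nhds hε)
    obtain ⟨N, ⟨hN1, hN2⟩, hN3⟩ := ((h1.and h2).and h3).exists
    have h5 := hs N n hN2
    have h6 : (s N ∩ Finset.Ico (0 : ℤ) n).card ≤ (w n).card := by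
      refine Finset.card_le_card fun i hi => ?_
      obtain ⟨hi1, hi2⟩ := Finset.mem_inter.1 hi
      exact Finset.mem_filter.2 ⟨hi2, hN1 i hi2 hi1⟩
    have h7 : ((s N ∩ Finset.Ico (0 : ℤ) n).card : ℝ) ≤ (w n).card := by exact_mod_cast h6
    linarith
  -- negative integers do not belong to `J`, so the symmetric density is half the one-sided one
  have hncard : ∀ n : ℕ, (J ∩ Set.Icc (-(n : ℤ)) n).ncard = (w (n + 1)).card := by
    intro n
    rw [← Set.ncard_coe_finset]
    congr 1
    ext i
    simp only [w, Set.mem_inter_iff, Set.mem_Icc, Finset.coe_filter, Finset.mem_Ico,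
      Set.mem_ofPred_eq]
    constructor
    · rintro ⟨h1, h2, h3⟩
      exact ⟨⟨h1.1, by push_cast; omega⟩, h1⟩
    · rintro ⟨⟨h1, h2⟩, h3⟩
      push_cast at h2
      exact ⟨h3, by omega, by omega⟩
  refine ⟨J, D / 2, by positivity, ?_, ?_, hJP⟩
  · have hratio : Tendsto (fun n : ℕ => ((n + 1 : ℕ) : ℝ) / (2 * n + 1)) atTop (𝓝 (1 / 2)) := by
      have h1 := (tendsto_one_div_add_atTop_nhds_zero_nat (𝕜 := ℝ))
      have h2 : Tendsto (fun n : ℕ => 1 / (2 - 1 / ((n : ℝ) + 1))) atTop (𝓝 (1 / (2 - 0))) :=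
        tendsto_const_nhds.div (tendsto_const_nhds.sub h1) (by norm_num)
      rw [sub_zero] at h2
      refine h2.congr fun n => ?_
      have h3 : ((n : ℝ) + 1) ≠ 0 := by positivity
      have h4 : (2 * (n : ℝ) + 1) ≠ 0 := by positivity
      have h5 : 2 - 1 / ((n : ℝ) + 1) = (2 * n + 1) / (n + 1) := by field_simp; ring
      rw [h5, one_div_div]
      push_cast
      rfl
    have hlo := hratio.const_mul D
    have hhi := (hlim.comp (tendsto_add_atTop_nat 1)).mul hratio
    rw [mul_one_div] at hlo hhi
    refine tendsto_of_tendsto_of_tendsto_of_le_of_le hlo hhi (fun n => ?_) (fun n => ?_)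
    · dsimp only
      rw [hncard, ← mul_div_assoc]
      exact div_le_div_of_nonneg_right (hlow (n + 1)) (by positivity)
    · dsimp only [Function.comp]
      rw [hncard, div_mul_div_cancel₀ (by positivity)]
      exact div_le_div_of_nonneg_right (hup (n + 1)) (by positivity)
  · intro hfin
    obtain ⟨n, hn⟩ := exists_nat_gt ((hfin.toFinset.card : ℝ) / D)
    rw [div_lt_iff₀ hD0] at hn
    have h1 : (w n).card ≤ hfin.toFinset.card := Finset.card_le_card fun i hi =>
      hfin.mem_toFinset.2 (Finset.mem_filter.1 hi).2
    have h2 : ((w n).card : ℝ) ≤ hfin.toFinset.card := by exact_mod_cast h1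
    have h3 := hlow n
    linarith

end Density

/-! ### The equivalences -/

section Equivalences

section Banach

variable {X : Type*} [NormedAddCommGroup X] [NormedSpace ℂ X] [CompleteSpace X]
  {α : X ≃ₗᵢ[ℂ] X} {x : X}

theorem exists_map_castEmbedding_eq {s : Finset ℤ} {n : ℕ} (hs : s ⊆ Finset.Ico (0 : ℤ) n) :
    ∃ I ⊆ Finset.range n, I.map Nat.castEmbedding = s := by
  classical
  refine ⟨s.image Int.toNat, fun i hi => ?_, ?_⟩
  · obtain ⟨j, hj, rfl⟩ := Finset.mem_image.1 hi
    have := Finset.mem_Ico.1 (hs hj)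
    rw [Finset.mem_range]
    omega
  · ext i
    simp only [Finset.mem_map, Finset.mem_image, exists_exists_and_eq_and, Nat.castEmbedding_apply]
    constructor
    · rintro ⟨j, hj, rfl⟩
      have := Finset.mem_Ico.1 (hs hj)
      rwa [Int.toNat_of_nonneg this.1]
    · intro hi
      have := Finset.mem_Ico.1 (hs hi)
      exact ⟨i, hi, Int.toNat_of_nonneg this.1⟩

theorem HasProportionalEllOneIterates.hasEllOneSetOfPosDensity
    (h : HasProportionalEllOneIterates α x) : HasEllOneSetOfPosDensity α x := by
  obtain ⟨δ, d, hδ, hd, h⟩ := hasProportionalEllOneIterates_iff.1 h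
  obtain ⟨J, D, hD, hJD, hJinf, hJ⟩ := exists_hasDensity_of_frequently (P := EllOneBound α x δ)
    (fun s t hst ht => ht.mono hst) (fun s m hs => hs.translate m) hd (h.mono (by
      rintro n ⟨I, hI, hcard, hbd⟩
      refine ⟨_, fun i hi => ?_, hbd, by rwa [Finset.card_map]⟩
      obtain ⟨j, hj, rfl⟩ := Finset.mem_map.1 hi
      have := Finset.mem_range.1 (hI hj)
      rw [Nat.castEmbedding_apply, Finset.mem_Ico]
      omega))
  exact ⟨J, D, hD, hJD, isEllOneIsomorphismSet_iff.2 ⟨hJinf, δ, hδ, hJ⟩⟩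

theorem HasEllOneSetOfPosDensity.hasProportionalEllOneIterates
    (h : HasEllOneSetOfPosDensity α x) : HasProportionalEllOneIterates α x := by
  classical
  obtain ⟨J, D, hD, hJD, hJ⟩ := h
  obtain ⟨-, δ, hδ, hbd⟩ := isEllOneIsomorphismSet_iff.1 hJ
  refine hasProportionalEllOneIterates_iff.2 ⟨δ, D / 2, hδ, by positivity, ?_⟩
  have htend : Tendsto (fun n : ℕ => 2 * n + 1) atTop atTop :=
    tendsto_atTop_mono (fun n => (by omega : n ≤ 2 * n + 1)) tendsto_id
  refine htend.frequently (Eventually.frequently ?_)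
  filter_upwards [hJD.eventually (lt_mem_nhds (half_lt_self hD))] with n hn
  rw [lt_div_iff₀ (by positivity)] at hn
  -- shift the window `{-n, …, n}` to `{0, …, 2n}`
  let t : Finset ℤ := (Finset.Icc (-(n : ℤ)) n).filter (· ∈ J)
  obtain ⟨I, hI, hIt⟩ := exists_map_castEmbedding_eq (s := t.map (addRightEmbedding (n : ℤ)))
    (n := 2 * n + 1) (by
      intro i hi
      obtain ⟨j, hj, rfl⟩ := Finset.mem_map.1 hi
      have := Finset.mem_Icc.1 (Finset.mem_filter.1 hj).1
      rw [addRightEmbedding_apply, Finset.mem_Ico]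
      push_cast
      omega)
  refine ⟨I, hI, ?_, ?_⟩
  · have h1 : I.card = t.card := by
      rw [← Finset.card_map Nat.castEmbedding (s := I) (β := ℤ), hIt, Finset.card_map]
    have h2 : (J ∩ Set.Icc (-(n : ℤ)) n).ncard = t.card := by
      rw [← Set.ncard_coe_finset]
      congr 1
      ext i
      simp only [t, Set.mem_inter_iff, Set.mem_Icc, Finset.coe_filter, Finset.mem_Icc,
        Set.mem_ofPred_eq]
      exact and_comm
    rw [h1, ← h2]
    push_cast
    exact hn.le
  · rw [hIt]
    exact (hbd t fun i hi => (Finset.mem_filter.1 hi).2).translate _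

end Banach

variable {A : Type*} [NonUnitalCStarAlgebra A] {α : A ≃⋆ₐ[ℂ] A} {Q : Set (WeakDual ℂ A)} {T : Q → Q}

theorem iterate_apply_eq (hT : ∀ σ a, (T σ : WeakDual ℂ A) a = (σ : WeakDual ℂ A) (α a)) (i : ℕ)
    (σ : Q) (a : A) :
    (T^[i] σ : WeakDual ℂ A) a = (σ : WeakDual ℂ A) ((autIsometry α ^ i) a) := by
  induction i generalizing σ with
  | zero => rfl
  | succ i ih =>
    rw [Function.iterate_succ_apply, ih, hT, pow_succ']
    rfl

theorem IsSelfAdjoint.autIsometry_pow {a : A} (ha : IsSelfAdjoint a) (i : ℕ) :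
    IsSelfAdjoint ((autIsometry α ^ i) a) := by
  induction i with
  | zero => exact ha
  | succ i ih =>
    rw [pow_succ']
    exact ih.map α

theorem IsPositiveFunctional.eq_of_re_eq_on_total {W : Set (selfAdjoint A)}
    (hW : Dense (Submodule.span ℝ W : Set (selfAdjoint A))) {σ τ : WeakDual ℂ A}
    (hσ : IsPositiveFunctional σ) (hτ : IsPositiveFunctional τ)
    (h : ∀ w ∈ W, (σ w).re = (τ w).re) : σ = τ := by
  have hsa : (fun b : selfAdjoint A => σ (b : A)) = fun b : selfAdjoint A => τ (b : A) := by
    refine Continuous.ext_on hW (by fun_prop) (by fun_prop) fun b hb => ?_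
    induction hb using Submodule.span_induction with
    | mem w hw =>
      exact Complex.ext (h w hw) (by rw [hσ.im_eq_zero w.2, hτ.im_eq_zero w.2])
    | zero => simp
    | add b c _ _ hb hc => rw [AddSubgroup.coe_add, map_add, map_add, hb, hc]
    | smul r b _ hb =>
      rw [selfAdjoint.val_smul, ← Complex.coe_smul, map_smul, map_smul, hb]
  refine DFunLike.ext _ _ fun a => ?_
  rw [← realPart_add_I_smul_imaginaryPart a, map_add, map_add, map_smul, map_smul,
    congrFun hsa (realPart a), congrFun hsa (imaginaryPart a)]

/-- A lower `ℓ₁` bound over the reals for a family of self-adjoint elements yields one over the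
complex numbers, by separating real and imaginary parts of the coefficients. -/
theorem complex_lower_bound_of_real {ι : Type*} (s : Finset ι) {v : ι → A}
    (hv : ∀ i, IsSelfAdjoint (v i)) {δ : ℝ}
    (h : ∀ b : ι → ℝ, δ * ∑ i ∈ s, |b i| ≤ ‖∑ i ∈ s, (b i : ℂ) • v i‖) (hδ : 0 ≤ δ) (c : ι → ℂ) :
    δ / 2 * ∑ i ∈ s, ‖c i‖ ≤ ‖∑ i ∈ s, c i • v i‖ := by
  set S : A := ∑ i ∈ s, c i • v i with hS
  have hre : (realPart S : A) = ∑ i ∈ s, ((c i).re : ℂ) • v i := by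
    rw [hS, map_sum, AddSubgroup.val_finsetSum]
    refine Finset.sum_congr rfl fun i _ => ?_
    rw [realPart_smul, (hv i).imaginaryPart, smul_zero, sub_zero, selfAdjoint.val_smul,
      (hv i).coe_realPart, Complex.coe_smul]
  have him : (imaginaryPart S : A) = ∑ i ∈ s, ((c i).im : ℂ) • v i := by
    rw [hS, map_sum, AddSubgroup.val_finsetSum]
    refine Finset.sum_congr rfl fun i _ => ?_
    rw [imaginaryPart_smul, (hv i).imaginaryPart, smul_zero, zero_add, selfAdjoint.val_smul,
      (hv i).coe_realPart, Complex.coe_smul]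
  have h1 : δ * ∑ i ∈ s, |(c i).re| ≤ ‖S‖ :=
    (h fun i => (c i).re).trans (by rw [← hre]; exact realPart.norm_le S)
  have h2 : δ * ∑ i ∈ s, |(c i).im| ≤ ‖S‖ :=
    (h fun i => (c i).im).trans (by rw [← him]; exact imaginaryPart.norm_le S)
  have h3 : ∑ i ∈ s, ‖c i‖ ≤ ∑ i ∈ s, |(c i).re| + ∑ i ∈ s, |(c i).im| := by
    rw [← Finset.sum_add_distrib]
    exact Finset.sum_le_sum fun i _ => Complex.norm_le_abs_re_add_abs_im _
  have h4 := mul_le_mul_of_nonneg_left h3 hδ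
  linarith

/-- Positive entropy on a compact invariant set of quasi-states yields, in any total set of
self-adjoint elements, an element whose orbit contains proportionally large copies of `ℓ₁`. -/
theorem exists_hasProportional_of_topEntropy_pos (hQ : IsCompact Q) (hQs : Q ⊆ quasiStateSpace A)
    (hT : ∀ σ a, (T σ : WeakDual ℂ A) a = (σ : WeakDual ℂ A) (α a))
    {W : Set (selfAdjoint A)} (hW : Dense (Submodule.span ℝ W : Set (selfAdjoint A)))
    (hpos : 0 < topEntropy T) :
    ∃ a ∈ W, HasProportionalEllOneIterates (autIsometry α) (a : A) := by
  have : CompactSpace Q := isCompact_iff_compactSpace.1 hQ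
  obtain ⟨⟨a, ha⟩, ε, d, hε, hd, h⟩ := exists_independent_iterates_of_topEntropy_pos hpos
    (g := fun (w : W) (σ : Q) => ((σ : WeakDual ℂ A) (w : A)).re)
    (fun w => Complex.continuous_re.comp
      ((WeakDual.eval_continuous _).comp continuous_subtype_val))
    (fun σ τ hστ => Subtype.ext (IsPositiveFunctional.eq_of_re_eq_on_total hW (hQs σ.2).1
      (hQs τ.2).1 fun w hw => hστ ⟨w, hw⟩))
  refine ⟨a, ha, hasProportionalEllOneIterates_iff.2 ⟨ε / 2 / 2, d, by positivity, hd,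
    h.mono ?_⟩⟩
  rintro n ⟨I, hI, hcard, hb⟩
  refine ⟨I, hI, hcard, fun c => ?_⟩
  rw [Finset.sum_map, Finset.sum_map]
  simp only [Nat.castEmbedding_apply, zpow_natCast]
  refine complex_lower_bound_of_real I (v := fun i => (autIsometry α ^ i) (a : A))
    (fun i => a.2.autIsometry_pow i) (fun b => ?_) (by positivity) fun i => c i
  obtain ⟨σ, τ, hστ⟩ := hb b
  set S : A := ∑ i ∈ I, (b i : ℂ) • (autIsometry α ^ i) (a : A) with hS
  have hval : ∀ ρ : WeakDual ℂ A,
      (ρ S).re = ∑ i ∈ I, b i * (ρ ((autIsometry α ^ i) (a : A))).re := by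
    intro ρ
    rw [hS, map_sum, Complex.re_sum]
    exact Finset.sum_congr rfl fun i _ => by rw [map_smul, smul_eq_mul, Complex.re_ofReal_mul]
  have hle : ∀ ρ : Q, |((ρ : WeakDual ℂ A) S).re| ≤ ‖S‖ := by
    intro ρ
    refine (Complex.abs_re_le_norm _).trans ?_
    have h1 := (WeakDual.toStrongDual (ρ : WeakDual ℂ A)).le_opNorm S
    refine h1.trans ?_
    exact mul_le_of_le_one_left (norm_nonneg _) (hQs ρ.2).2
  have h1 : ∑ i ∈ I, b i * (((T^[i] σ : Q) : WeakDual ℂ A) (a : A)).re -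
      ∑ i ∈ I, b i * (((T^[i] τ : Q) : WeakDual ℂ A) (a : A)).re =
      ((σ : WeakDual ℂ A) S).re - ((τ : WeakDual ℂ A) S).re := by
    rw [hval, hval]
    simp only [iterate_apply_eq hT]
  simp only [mul_sub, Finset.sum_sub_distrib] at hστ
  rw [h1] at hστ
  have h2 := (abs_le.1 (hle σ)).2
  have h3 := (abs_le.1 (hle τ)).1
  linarith

/-- Proportionally large copies of `ℓ₁` along an orbit force infinite entropy on every compact
invariant set of functionals whose bounded multiples exhaust the quasi-states. -/
theorem topEntropy_eq_top_of_hasProportional (hQ : IsCompact Q)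
    (hT : ∀ σ a, (T σ : WeakDual ℂ A) a = (σ : WeakDual ℂ A) (α a)) {a : A}
    (ha : HasProportionalEllOneIterates (autIsometry α) a)
    (hex : ∀ σ ∈ quasiStateSpace A, ∃ τ ∈ Q, ∃ t : ℂ, ‖t‖ ≤ 1 ∧ ∀ b, σ b = t * τ b) :
    topEntropy T = ⊤ := by
  classical
  have : CompactSpace Q := isCompact_iff_compactSpace.1 hQ
  obtain ⟨δ, d, hδ, hd, h⟩ := hasProportionalEllOneIterates_iff.1 ha
  refine topEntropy_eq_top_of_interpolation (g := fun σ : Q => (σ : WeakDual ℂ A) a)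
    ((WeakDual.eval_continuous _).comp continuous_subtype_val) (M := 3 / δ) hd (h.mono ?_)
  rintro n ⟨I, hI, hcard, hbd⟩
  refine ⟨I, hI, hcard, fun l hl => ?_⟩
  obtain ⟨x, hx, hxl⟩ := exists_quasiStates_interpolating
    (fun i : I => (autIsometry α ^ (i : ℕ)) a) hδ (fun c => by
      have h1 := hbd fun i => if hi : i.toNat ∈ I then c ⟨i.toNat, hi⟩ else 0
      rw [Finset.sum_map, Finset.sum_map, ← Finset.sum_coe_sort I, ← Finset.sum_coe_sort I] at h1
      simpa using h1) (fun i => l i) fun i => hl i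
  choose τ hτQ t ht hτ using fun j => hex (x j) (hx j)
  refine ⟨fun j => ⟨τ j, hτQ j⟩, fun j => ((3 / δ : ℝ) : ℂ) * Complex.I ^ (j : ℕ) * t j,
    fun j => ?_, fun i hi => ?_⟩
  · rw [norm_mul, norm_mul, norm_pow, Complex.norm_I, one_pow, mul_one, Complex.norm_real,
      Real.norm_of_nonneg (by positivity)]
    exact mul_le_of_le_one_right (by positivity) (ht j)
  · rw [hxl ⟨i, hi⟩, fourfoldEval]
    refine Finset.sum_congr rfl fun j _ => ?_
    rw [iterate_apply_eq hT, hτ, mul_assoc _ (t j)]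

end Equivalences

theorem theorem2p2 {A : Type*} [NonUnitalCStarAlgebra A] [TopologicalSpace.SeparableSpace A]
    (α : A ≃⋆ₐ[ℂ] A) :
    -- the equivalence of (1), (2), (3)
    [topEntropy (quasiStateHomeo α) = ⊤,
      ∃ a : A, HasProportionalEllOneIterates (autIsometry α) a,
      ∃ a : A, HasEllOneSetOfPosDensity (autIsometry α) a].TFAE ∧
    -- the element can be taken from any countable total subset of the self-adjoint part
    (∀ W : Set (selfAdjoint A), W.Countable →
      Dense (Submodule.span ℝ W : Set (selfAdjoint A)) →
      [topEntropy (quasiStateHomeo α) = ⊤,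
        ∃ a ∈ W, HasProportionalEllOneIterates (autIsometry α) (a : A),
        ∃ a ∈ W, HasEllOneSetOfPosDensity (autIsometry α) (a : A)].TFAE) ∧
    -- the unital case
    (∀ (e : A) (he : IsAlgebraUnit e),
      [topEntropy (quasiStateHomeo α) = ⊤,
        ∃ a : A, HasProportionalEllOneIterates (autIsometry α) a,
        ∃ a : A, HasEllOneSetOfPosDensity (autIsometry α) a,
        topEntropy (stateHomeo α he) = ⊤].TFAE) := by
  have hentropy : ∀ W : Set (selfAdjoint A), Dense (Submodule.span ℝ W : Set (selfAdjoint A)) →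
      topEntropy (quasiStateHomeo α) = ⊤ →
        ∃ a ∈ W, HasProportionalEllOneIterates (autIsometry α) (a : A) := fun W hW h =>
    exists_hasProportional_of_topEntropy_pos isCompact_quasiStateSpace subset_rfl
      (fun _ _ => rfl) hW (by rw [h]; exact EReal.zero_lt_top)
  have huniv : Dense (Submodule.span ℝ (Set.univ : Set (selfAdjoint A)) : Set (selfAdjoint A)) := by
    simp
  have htop : ∀ a : A, HasProportionalEllOneIterates (autIsometry α) a →
      topEntropy (quasiStateHomeo α) = ⊤ := fun a ha =>
    topEntropy_eq_top_of_hasProportional isCompact_quasiStateSpace (fun _ _ => rfl) ha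
      fun σ hσ => ⟨σ, hσ, 1, by simp, fun b => (one_mul _).symm⟩
  refine ⟨?_, fun W _ hW => ?_, fun e he => ?_⟩
  · tfae_have 1 → 2 := fun h => (hentropy Set.univ huniv h).imp' _ fun _ ha => ha.2
    tfae_have 2 → 3 := fun ⟨a, ha⟩ => ⟨a, ha.hasEllOneSetOfPosDensity⟩
    tfae_have 3 → 1 := fun ⟨a, ha⟩ => htop a ha.hasProportionalEllOneIterates
    tfae_finish
  · tfae_have 1 → 2 := hentropy W hW
    tfae_have 2 → 3 := fun ⟨a, haW, ha⟩ => ⟨a, haW, ha.hasEllOneSetOfPosDensity⟩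
    tfae_have 3 → 1 := fun ⟨a, _, ha⟩ => htop a ha.hasProportionalEllOneIterates
    tfae_finish
  · tfae_have 1 → 2 := fun h => (hentropy Set.univ huniv h).imp' _ fun _ ha => ha.2
    tfae_have 2 → 3 := fun ⟨a, ha⟩ => ⟨a, ha.hasEllOneSetOfPosDensity⟩
    tfae_have 3 → 1 := fun ⟨a, ha⟩ => htop a ha.hasProportionalEllOneIterates
    tfae_have 2 → 4 := fun ⟨a, ha⟩ =>
      topEntropy_eq_top_of_hasProportional (isCompact_stateSpace he) (fun _ _ => rfl) ha
        fun σ hσ => exists_state_of_quasiState he ha.ne_zero hσ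
    tfae_have 4 → 2 := fun h =>
      (exists_hasProportional_of_topEntropy_pos (T := stateHomeo α he) (isCompact_stateSpace he)
        (stateSpace_subset_quasiStateSpace he) (fun _ _ => rfl) huniv
        (by rw [h]; exact EReal.zero_lt_top)).imp' _ fun _ ha => ha.2
    tfae_finish
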